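/- **Setting.** A 1-bit mean estimator with $n$ samples is an interactive protocol with $n$ rounds. In round $t=1,\dots,n$ the learner chooses a measurable function $Q_t:\mathbb{R}\to\{0,1\}$, possibly using internal randomness that is independent of the samples, and possibly depending on the history $(Q_1,Y_1,\dots,Q_{t-1},Y_{t-1})$. It then receives the single bit $Y_t=Q_t(X_t)$, where $X_1,\dots,X_n$ are i.i.d. with unknown law $D$. After round $n$ it outputs an estimate $\hat\mu\in\mathbb{R}$ that is a function of the transcript $(Q_1,Y_1,\dots,Q_n,Y_n)$. The estimator is $(\epsilon,\delta)$-PAC for a family $\mathcal{D}$ of distributions if $\Pr(|\hat\mu-\mu(D)|\le\epsilon)\ge 1-\delta$ for every $D\in\mathcal{D}$, where $\mu(D)$ is the mean of $D$. For real $k>2$ and $\lambda\ge\sigma>0$, let $\mathcal{D}_k(\lambda,\sigma)$ be the family of all distributions on $\mathbb{R}$ with mean $\mu\in[-\lambda,\lambda]$ and $\mathbb{E}|X-\mu|^k\le\sigma^k$. **Theorem.** There is a universal constant $C>0$ such that for all real $k>2$, $\lambda\ge\sigma>0$, $0<\epsilon<\sigma$ and $0<\delta<1$ there exists a 1-bit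 mean estimator (which may depend on $k,\lambda,\sigma,\epsilon,\delta$) that is $(\epsilon,\delta)$-PAC for $\mathcal{D}_k(\lambda,\sigma)$ and whose number of samples $n$ satisfies $$n\le C\left(\frac{\sigma^2}{\epsilon^2}\,\ell^3\,\log\frac{\ell}{\delta}+\log\frac{\lambda}{\sigma}\right),\qquad \ell=\max\left\{2,\ \log_{k/2}\log\frac{\sigma}{\epsilon}\right\},$$ that is, with sample complexity $$O\left(\frac{\sigma^2}{\epsilon^2}\Big(\log_{k/2}\log\frac{\sigma}{\epsilon}\Big)^3\log\left(\frac{\log_{k/2}\log(\sigma/\epsilon)}{\delta}\right)+\log\frac{\lambda}{\sigma}\right).$$ -/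

import Mathlib

open MeasureTheory

namespace OneBitMean

/-- One round of interaction: the 1-bit quantization function `Q` sent by the learner and the
bit `Y = Q X` sent back by the agent. -/
abbrev Round : Type := (ℝ → Bool) × Bool

/-- The transcript `[(Q₁, Y₁), …, (Qₜ, Yₜ)]` after `t` rounds, when the learner has internal
randomness `s`, selects each quantization function from `s` and the transcript so far,
and the samples seen by the agent are `x 0, …, x (t - 1)`, one fresh sample per round. -/
def transcript {S : Type} (query : S → List Round → (ℝ → Bool)) (s : S) :
    (t : ℕ) → (Fin t → ℝ) → List Round
  | 0, _ => []
  | t + 1, x =>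
      let h := transcript query s t (Fin.init x)
      let Q := query s h
      h ++ [(Q, Q (x (Fin.last t)))]

/-- A (possibly randomized, adaptive) 1-bit mean estimator that uses `n` samples. -/
structure Estimator (n : ℕ) where
  /-- the space of the learner's internal randomness -/
  Seed : Type
  [seedSpace : MeasurableSpace Seed]
  /-- the law of the learner's internal randomness -/
  seedLaw : Measure Seed
  [seedProb : IsProbabilityMeasure seedLaw]
  /-- the query strategy: the next quantization function, from the internal randomness and the
  history of interactions (the index of the round is the length of the history) -/
  query : Seed → List Round → (ℝ → Bool)
  /-- the estimation rule: a function of the full transcript only -/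
  estimate : List Round → ℝ
  /-- every feedback bit is a random variable -/
  measurable_feedback : ∀ t < n, Measurable fun p : Seed × (Fin t → ℝ) × ℝ =>
    query p.1 (transcript query p.1 t p.2.1) p.2.2
  /-- the estimate is a random variable -/
  measurable_estimate : Measurable fun p : Seed × (Fin n → ℝ) =>
    estimate (transcript query p.1 n p.2)

attribute [instance] Estimator.seedSpace Estimator.seedProb

/-- The estimate produced from internal randomness `s` and samples `x`. -/
def Estimator.output {n : ℕ} (A : Estimator n) (s : A.Seed) (x : Fin n → ℝ) : ℝ :=
  A.estimate (transcript A.query s n x)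

/-- The mean of a distribution on `ℝ`. -/
noncomputable def mean (D : Measure ℝ) : ℝ := ∫ x, x ∂D

/-- `A` is `(ε, δ)`-PAC for the family `𝓓`: for each `D ∈ 𝓓`, when the samples are i.i.d. with
law `D` and independent of the internal randomness, the estimate is `ε`-correct with probability
at least `1 - δ`. -/
def Estimator.IsPAC {n : ℕ} (A : Estimator n) (𝓓 : Set (Measure ℝ)) (ε δ : ℝ) : Prop :=
  ∀ D ∈ 𝓓, 1 - δ ≤ (A.seedLaw.prod (Measure.pi fun _ : Fin n => D)).real
    {p | |A.output p.1 p.2 - mean D| ≤ ε}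

/-- The distributions on `ℝ` with mean in `[-lam, lam]` and `k`-th absolute central moment at most
`σ ^ k`. (For `k > 2` the variance bound `σ ^ 2` is a consequence.) -/
def momentFamily (k lam σ : ℝ) : Set (Measure ℝ) :=
  {D | IsProbabilityMeasure D ∧
    Integrable (fun x : ℝ => x) D ∧ mean D ∈ Set.Icc (-lam) lam ∧
    Integrable (fun x : ℝ => |x - mean D| ^ k) D ∧ ∫ x, |x - mean D| ^ k ∂D ≤ σ ^ k}

/-- `log_{k/2} log r`, with values below `2` replaced by `2`. -/
noncomputable def logLog (k r : ℝ) : ℝ := max 2 (Real.logb (k / 2) (Real.log r))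

end OneBitMean

/-!
Rescaling aside, a sample is first located to within `9 * σ` of the mean and then averaged through
randomised thresholds around that point.

In the first stage the line near `[-lam, lam]` is cut into `m + 1` cells of width `6 * σ`. Every round
colours the cells by independent fair bits and asks for the colour of the cell of the sample. The
colour of cell `j` agrees with the answer with probability `(1 + D (cell j)) / 2`
(`integral_agreement`), so the cell that agrees most often has large mass and hence lies near the mean
(`abs_cellPoint_sub_le_of_agreement`). A union bound over the cells costs `O(log (lam / σ) + log (1 / δ))`
rounds.

In the second stage let `c` be the point found and `Y = (X - c) / (10 * σ)`, so that `E |Y| ^ k ≤ 1`.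
Since `y` is the integral over all thresholds `u` of the signed indicator that `u` separates `0` from
`y`, a single comparison of `Y` with a random threshold of density `g / S`, weighted by `S / g`,
estimates `Y` without bias, up to truncation at `R ^ (2 / k)` where `R = 20 * σ / ε`. The choice
`g u = (max 1 |u|) ^ (-k / 2)`, the square root of the tail bound, makes the second moment at most
`S ^ 2` (`integral_weightedBit_sq_le`); the truncation bias is at most `1 / R`
(`abs_integral_weightedBit_sub_le`) and the range is at most `S * R`. Bernstein's inequality
(`measure_abs_sum_sub_ge_le`) then asks for `O(S ^ 2 * R ^ 2 * log (1 / δ))` rounds. Finally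
`S = O(min (1 / (k - 2)) (log R))`, which is at most a constant times `logLog k (σ / ε)`
(`envelopeMass_le_logLog`), so two of the three powers of that factor in the bound already suffice.

The two stages are decoupled by a union bound over the at most four cells within `9 * σ` of the mean
(`card_near_cells_le`), for each of which the second-stage statistic is a sum of i.i.d. terms. The
estimate may use the queries but not the seed: it reads the codes off the queries at the ends of the
cells, and the thresholds as infima.
-/

open ProbabilityTheory

namespace OneBitMean

/-! ### A Bernstein inequality for i.i.d. samples -/

theorem integrable_of_bounded {Ω : Type*} [MeasurableSpace Ω] {P : Measure Ω} [IsFiniteMeasure P]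
    {f : Ω → ℝ} (hf : Measurable f) {B : ℝ} (hB : ∀ ω, |f ω| ≤ B) : Integrable f P :=
  Integrable.of_bound hf.aestronglyMeasurable B (Filter.Eventually.of_forall hB)

/-- Bernstein's estimate of the moment generating function, from `exp x ≤ 1 + x + x ^ 2` on
`[-1, 1]`. The second moment is not centred. -/
theorem mgf_le_of_bounded {Ω : Type*} [MeasurableSpace Ω] {P : Measure Ω} [IsProbabilityMeasure P]
    {f : Ω → ℝ} (hf : Measurable f) {B V s : ℝ} (hB : ∀ ω, |f ω| ≤ B) (hs : |s| * B ≤ 1)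
    (hV : ∫ ω, f ω ^ 2 ∂P ≤ V) :
    mgf f P s ≤ Real.exp (s * ∫ ω, f ω ∂P + s ^ 2 * V) := by
  have hsf : ∀ ω, |s * f ω| ≤ 1 := fun ω => by
    rw [abs_mul]
    exact (mul_le_mul_of_nonneg_left (hB ω) (abs_nonneg s)).trans hs
  have hint : Integrable f P := integrable_of_bounded hf hB
  have hint2 : Integrable (fun ω => f ω ^ 2) P := by
    refine integrable_of_bounded (hf.pow_const 2) (B := B ^ 2) fun ω => ?_
    rw [abs_pow]
    exact pow_le_pow_left₀ (abs_nonneg _) (hB ω) 2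
  have hexp : Integrable (fun ω => Real.exp (s * f ω)) P := by
    refine integrable_of_bounded (by fun_prop) (B := Real.exp 1) fun ω => ?_
    rw [abs_of_pos (Real.exp_pos _)]
    exact Real.exp_le_exp.2 ((le_abs_self _).trans (hsf ω))
  calc mgf f P s = ∫ ω, Real.exp (s * f ω) ∂P := rfl
    _ ≤ ∫ ω, (1 + s * f ω + s ^ 2 * f ω ^ 2) ∂P := by
        refine integral_mono hexp (by fun_prop) fun ω => ?_
        have := (abs_le.1 (Real.abs_exp_sub_one_sub_id_le (hsf ω))).2
        simp only
        linarith [mul_pow s (f ω) 2]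
    _ = 1 + s * ∫ ω, f ω ∂P + s ^ 2 * ∫ ω, f ω ^ 2 ∂P := by
        rw [integral_add (by fun_prop) (by fun_prop), integral_add (by fun_prop) (by fun_prop),
          integral_const_mul, integral_const_mul]
        simp
    _ ≤ s * ∫ ω, f ω ∂P + s ^ 2 * V + 1 := by
        linarith [mul_le_mul_of_nonneg_left hV (sq_nonneg s)]
    _ ≤ _ := Real.add_one_le_exp _

theorem integral_comp_of_measurePreserving {α β : Type*} [MeasurableSpace α] [MeasurableSpace β]
    {μ : Measure α} {ν : Measure β} {φ : α → β} (hφ : MeasurePreserving φ μ ν) {f : β → ℝ}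
    (hf : Measurable f) : ∫ a, f (φ a) ∂μ = ∫ b, f b ∂ν := by
  rw [← hφ.map_eq, integral_map hφ.measurable.aemeasurable hf.aestronglyMeasurable]

theorem measure_sum_ge_le_of_bounded {Ω ι κ : Type*} [MeasurableSpace Ω] [Fintype ι] [Fintype κ]
    (P : Measure Ω) [IsProbabilityMeasure P] {e : κ → ι} (he : Function.Injective e)
    {f : Ω → ℝ} (hf : Measurable f) {B V η : ℝ} (hB : ∀ ω, |f ω| ≤ B)
    (hV : ∫ ω, f ω ^ 2 ∂P ≤ V) (hη : 0 < η) (hV0 : 0 < V) (hηB : η * B ≤ 2 * V) :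
    (Measure.pi fun _ : ι => P).real
        {ω | Fintype.card κ * (∫ ω, f ω ∂P + η) ≤ ∑ i, f (ω (e i))} ≤
      Real.exp (-(Fintype.card κ * η ^ 2 / (4 * V))) := by
  -- the value of `s` that minimises `s ^ 2 * V - s * η`
  set s : ℝ := η / (2 * V) with hs
  have hs0 : 0 < s := by positivity
  have hsB : |s| * B ≤ 1 := by
    rw [abs_of_pos hs0, hs, div_mul_eq_mul_div, div_le_one (by positivity)]
    exact hηB
  set m := ∫ ω, f ω ∂P
  have hmeas : ∀ i : κ, Measurable fun ω : ι → Ω => f (ω (e i)) := fun i =>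
    hf.comp (measurable_pi_apply _)
  have hind : iIndepFun (fun (i : κ) (ω : ι → Ω) => f (ω (e i))) (Measure.pi fun _ : ι => P) :=
    (iIndepFun_pi (μ := fun _ : ι => P) (X := fun _ => f) fun _ => hf.aemeasurable).precomp he
  have hmgf : ∀ i : κ, mgf (fun ω : ι → Ω => f (ω (e i))) (Measure.pi fun _ : ι => P) s
      = mgf f P s := fun i =>
    integral_comp_of_measurePreserving (measurePreserving_eval (fun _ : ι => P) (e i))
      (f := fun ω => Real.exp (s * f ω)) (by fun_prop)
  have hsum : mgf (fun ω : ι → Ω => ∑ i, f (ω (e i))) (Measure.pi fun _ : ι => P) s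
      = mgf f P s ^ Fintype.card κ := by
    have := hind.mgf_sum (t := s) hmeas Finset.univ
    simp only [hmgf, Finset.prod_const, Finset.card_univ] at this
    rw [← this]
    congr 1
    ext ω
    simp
  have hBsum : ∀ ω : ι → Ω, |s * ∑ i, f (ω (e i))| ≤ |s| * ∑ _i : κ, B := fun ω => by
    rw [abs_mul]
    exact mul_le_mul_of_nonneg_left ((Finset.abs_sum_le_sum_abs _ _).trans
      (Finset.sum_le_sum fun i _ => hB _)) (abs_nonneg _)
  refine (measure_ge_le_exp_mul_mgf _ hs0.le ?_).trans ?_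
  · refine integrable_of_bounded (by fun_prop) (B := Real.exp (|s| * ∑ _i : κ, B)) fun ω => ?_
    rw [abs_of_pos (Real.exp_pos _)]
    exact Real.exp_le_exp.2 ((le_abs_self _).trans (hBsum ω))
  · rw [hsum]
    calc Real.exp (-s * (Fintype.card κ * (m + η))) * mgf f P s ^ Fintype.card κ
        ≤ Real.exp (-s * (Fintype.card κ * (m + η))) *
            Real.exp (s * m + s ^ 2 * V) ^ Fintype.card κ := by
          gcongr
          · exact mgf_nonneg
          · exact mgf_le_of_bounded hf hB hsB hV
      _ = _ := by
          rw [← Real.exp_nat_mul, ← Real.exp_add]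
          congr 1
          rw [hs]
          field_simp
          ring

/-- Bernstein's inequality for the average of a bounded statistic `f` over those coordinates of an
i.i.d. vector that are listed by `e`. -/
theorem measure_abs_sum_sub_ge_le {Ω ι κ : Type*} [MeasurableSpace Ω] [Fintype ι] [Fintype κ]
    (P : Measure Ω) [IsProbabilityMeasure P] {e : κ → ι} (he : Function.Injective e)
    {f : Ω → ℝ} (hf : Measurable f) {B V η : ℝ} (hB : ∀ ω, |f ω| ≤ B)
    (hV : ∫ ω, f ω ^ 2 ∂P ≤ V) (hη : 0 < η) (hV0 : 0 < V) (hηB : η * B ≤ 2 * V) :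
    (Measure.pi fun _ : ι => P).real
        {ω | Fintype.card κ * η ≤ |∑ i, f (ω (e i)) - Fintype.card κ * ∫ ω, f ω ∂P|} ≤
      2 * Real.exp (-(Fintype.card κ * η ^ 2 / (4 * V))) := by
  have h1 := measure_sum_ge_le_of_bounded P he hf hB hV hη hV0 hηB
  have h2 := measure_sum_ge_le_of_bounded P he (f := fun ω => -f ω) hf.neg (B := B)
    (by simpa using hB) (by simpa using hV) hη hV0 hηB
  rw [two_mul]
  refine le_trans ?_ (add_le_add h1 h2)
  refine le_trans (measureReal_mono ?_) (measureReal_union_le _ _)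
  intro ω hω
  simp only [Set.mem_ofPred_eq, Set.mem_union, integral_neg, Finset.sum_neg_distrib] at hω ⊢
  rcases le_abs.1 hω with h | h
  · left; linarith
  · right; linarith

/-! ### Randomised thresholds -/

/-- The signed indicator that the threshold `u` separates `0` from `y`. Its integral over all
thresholds `u` is `y`. -/
noncomputable def crossing (u y : ℝ) : ℝ := (if u < y then 1 else 0) - (if u < 0 then 1 else 0)

theorem measurable_crossing : Measurable fun p : ℝ × ℝ => crossing p.1 p.2 := by
  unfold crossing
  refine Measurable.sub ?_ ?_
  · exact Measurable.ite (measurableSet_lt measurable_fst measurable_snd) measurable_const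
      measurable_const
  · exact Measurable.ite (measurableSet_lt measurable_fst measurable_const) measurable_const
      measurable_const

theorem abs_crossing_le_one (u y : ℝ) : |crossing u y| ≤ 1 := by
  unfold crossing
  split_ifs <;> simp

theorem crossing_sq_le (u y : ℝ) :
    crossing u y ^ 2 ≤ Set.indicator {z : ℝ | |u| ≤ |z|} (fun _ => 1) y := by
  by_cases h : |u| ≤ |y|
  · rw [Set.indicator_of_mem (show y ∈ {z : ℝ | |u| ≤ |z|} from h), sq_le_one_iff_abs_le_one]
    exact abs_crossing_le_one u y
  · rw [Set.indicator_of_notMem (show y ∉ {z : ℝ | |u| ≤ |z|} from h)]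
    push Not at h
    have : crossing u y = 0 := by
      unfold crossing
      obtain ⟨h1, h2⟩ := abs_lt.1 h
      rcases le_or_gt 0 u with hu | hu
      · rw [abs_of_nonneg hu] at h1 h2
        rw [if_neg (by linarith), if_neg (by linarith), sub_zero]
      · rw [abs_of_neg hu] at h1 h2
        rw [if_pos (by linarith), if_pos hu, sub_self]
    rw [this]; norm_num

theorem setIntegral_crossing {M : ℝ} (hM : 0 ≤ M) (y : ℝ) :
    ∫ u in Set.Icc (-M) M, crossing u y = max (-M) (min M y) := by
  have hmeas : ∀ y : ℝ, Measurable fun u : ℝ => if u < y then (1 : ℝ) else 0 := fun y =>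
    Measurable.ite measurableSet_Iio measurable_const measurable_const
  have hint : ∀ y : ℝ, Integrable (fun u : ℝ => if u < y then (1 : ℝ) else 0)
      (volume.restrict (Set.Icc (-M) M)) := fun y => by
    refine integrable_of_bounded (hmeas y) (B := 1) fun u => ?_
    split_ifs <;> simp
  have key : ∀ y : ℝ, ∫ u in Set.Icc (-M) M, (if u < y then (1 : ℝ) else 0) =
      max (-M) (min M y) + M := fun y => by
    have h1 : (fun u : ℝ => if u < y then (1 : ℝ) else 0) = (Set.Iio y).indicator fun _ => 1 := by
      ext u; simp [Set.indicator]
    rw [h1, setIntegral_indicator measurableSet_Iio, setIntegral_const, smul_eq_mul, mul_one]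
    rcases le_or_gt y (-M) with hy | hy
    · have : Set.Icc (-M) M ∩ Set.Iio y = ∅ := by
        ext u; simp only [Set.mem_inter_iff, Set.mem_Icc, Set.mem_Iio, Set.mem_empty_iff_false,
          iff_false]
        rintro ⟨⟨h, -⟩, h'⟩; linarith
      rw [this, max_eq_left ((min_le_right _ _).trans hy)]; simp
    · rcases le_or_gt y M with hy' | hy'
      · have : Set.Icc (-M) M ∩ Set.Iio y = Set.Ico (-M) y := by
          ext u; simp only [Set.mem_inter_iff, Set.mem_Icc, Set.mem_Iio, Set.mem_Ico]
          constructor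
          · rintro ⟨⟨h, -⟩, h'⟩; exact ⟨h, h'⟩
          · rintro ⟨h, h'⟩; exact ⟨⟨h, by linarith⟩, h'⟩
        rw [this, min_eq_right hy', max_eq_right hy.le, Measure.real, Real.volume_Ico,
          ENNReal.toReal_ofReal (by linarith)]
        ring
      · have : Set.Icc (-M) M ∩ Set.Iio y = Set.Icc (-M) M :=
          Set.inter_eq_left.2 fun u hu => lt_of_le_of_lt hu.2 hy'
        rw [this, min_eq_left hy'.le, max_eq_right (by linarith), Measure.real, Real.volume_Icc,
          ENNReal.toReal_ofReal (by linarith)]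
        ring
  unfold crossing
  rw [integral_sub (hint y) (hint 0), key, key, min_eq_right hM,
    max_eq_right (by linarith : -M ≤ 0)]
  ring

/-- The bound `(max 1 |u|) ^ (-k / 2)` for the square root of the tail `P (|u| ≤ |Y|)` of a variable
with `E |Y| ^ k ≤ 1`. It is the optimal importance density for the thresholds, up to
normalisation. It is kept above `1 / R`, which changes it only outside the interval
`[-truncation k R, truncation k R]`, where no threshold is drawn. -/
noncomputable def tailEnvelope (k R u : ℝ) : ℝ := max R⁻¹ (max 1 |u| ^ (-(k / 2)))

/-- The largest threshold `R ^ (2 / k)`: the point where `u ^ (-k / 2)` falls to `1 / R`. -/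
noncomputable def truncation (k R : ℝ) : ℝ := R ^ (2 / k)

/-- The normalising constant of the density `tailEnvelope`. -/
noncomputable def envelopeMass (k R : ℝ) : ℝ :=
  ∫ u in Set.Icc (-truncation k R) (truncation k R), tailEnvelope k R u

/-- The law of a random threshold: it has density proportional to `tailEnvelope` on
`[-truncation k R, truncation k R]`. -/
noncomputable def thresholdLaw (k R : ℝ) : Measure ℝ :=
  (volume.restrict (Set.Icc (-truncation k R) (truncation k R))).withDensity
    fun u => ENNReal.ofReal (tailEnvelope k R u / envelopeMass k R)

/-- The importance-weighted value of one threshold bit: an unbiased estimate of `y` truncated to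
`[-truncation k R, truncation k R]`. -/
noncomputable def weightedBit (k R u y : ℝ) : ℝ :=
  envelopeMass k R / tailEnvelope k R u * crossing u y

theorem measurable_tailEnvelope (k R : ℝ) : Measurable (tailEnvelope k R) := by
  unfold tailEnvelope
  fun_prop

theorem measurable_weightedBit (k R : ℝ) :
    Measurable fun p : ℝ × ℝ => weightedBit k R p.1 p.2 := by
  unfold weightedBit
  exact (measurable_const.div ((measurable_tailEnvelope k R).comp measurable_fst)).mul
    measurable_crossing

section

variable {k R : ℝ}

theorem inv_le_tailEnvelope (u : ℝ) : R⁻¹ ≤ tailEnvelope k R u := le_max_left _ _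

theorem tailEnvelope_pos (hR : 1 ≤ R) (u : ℝ) : 0 < tailEnvelope k R u :=
  (inv_pos.2 (by linarith)).trans_le (inv_le_tailEnvelope u)

theorem tailEnvelope_le_one (hk : 2 < k) (hR : 1 ≤ R) (u : ℝ) : tailEnvelope k R u ≤ 1 :=
  max_le (inv_le_one_of_one_le₀ hR)
    (Real.rpow_le_one_of_one_le_of_nonpos (le_max_left _ _) (by linarith))

theorem one_le_truncation (hk : 2 < k) (hR : 1 ≤ R) : 1 ≤ truncation k R :=
  Real.one_le_rpow hR (by positivity)

theorem truncation_rpow_half (hk : 2 < k) (hR : 1 ≤ R) : truncation k R ^ (k / 2) = R := by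
  rw [truncation, ← Real.rpow_mul (by linarith)]
  rw [show 2 / k * (k / 2) = 1 by field_simp, Real.rpow_one]

theorem tailEnvelope_eq (hk : 2 < k) (hR : 1 ≤ R) {u : ℝ} (hu : |u| ≤ truncation k R) :
    tailEnvelope k R u = max 1 |u| ^ (-(k / 2)) := by
  refine max_eq_right ?_
  have hM := one_le_truncation hk hR
  rw [Real.rpow_neg (by positivity)]
  refine inv_anti₀ (by positivity) ?_
  calc max 1 |u| ^ (k / 2) ≤ truncation k R ^ (k / 2) :=
        Real.rpow_le_rpow (by positivity) (max_le hM hu) (by linarith)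
    _ = R := truncation_rpow_half hk hR

theorem integrable_tailEnvelope (hk : 2 < k) (hR : 1 ≤ R) (μ : Measure ℝ) [IsFiniteMeasure μ] :
    Integrable (tailEnvelope k R) μ :=
  integrable_of_bounded (measurable_tailEnvelope k R) (B := 1) fun u => by
    rw [abs_of_pos (tailEnvelope_pos hR u)]
    exact tailEnvelope_le_one hk hR u

theorem two_le_envelopeMass (hk : 2 < k) (hR : 1 ≤ R) : 2 ≤ envelopeMass k R := by
  have hM := one_le_truncation hk hR
  calc (2 : ℝ) = ∫ u in Set.Icc (-1 : ℝ) 1, (1 : ℝ) := by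
        rw [setIntegral_const, Measure.real, Real.volume_Icc, ENNReal.toReal_ofReal (by norm_num)]
        norm_num
    _ = ∫ u in Set.Icc (-1 : ℝ) 1, tailEnvelope k R u := by
        refine setIntegral_congr_fun measurableSet_Icc fun u hu => ?_
        have hu1 : |u| ≤ 1 := abs_le.2 hu
        rw [tailEnvelope_eq hk hR (hu1.trans hM), max_eq_left hu1, Real.one_rpow]
    _ ≤ envelopeMass k R := by
        refine setIntegral_mono_set (integrable_tailEnvelope hk hR _)
          (Filter.Eventually.of_forall fun u => (tailEnvelope_pos hR u).le) ?_
        exact (Set.Icc_subset_Icc (by linarith) hM).eventuallyLE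

theorem envelopeMass_eq (hk : 2 < k) (hR : 1 ≤ R) :
    envelopeMass k R = 2 + 2 * ∫ u in (1 : ℝ)..truncation k R, u ^ (-(k / 2)) := by
  have hM := one_le_truncation hk hR
  set M := truncation k R with hMdef
  have hint : ∀ a b : ℝ, IntervalIntegrable (tailEnvelope k R) volume a b := fun a b =>
    ⟨integrable_tailEnvelope hk hR _, integrable_tailEnvelope hk hR _⟩
  have hpos : ∫ u in (1 : ℝ)..M, tailEnvelope k R u = ∫ u in (1 : ℝ)..M, u ^ (-(k / 2)) := by
    refine intervalIntegral.integral_congr fun u hu => ?_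
    rw [Set.uIcc_of_le hM] at hu
    have hu' : |u| = u := abs_of_nonneg (by linarith [hu.1])
    rw [tailEnvelope_eq hk hR (by rw [hu']; exact hu.2), hu', max_eq_right hu.1]
  have hneg : ∫ u in (-M)..(-1 : ℝ), tailEnvelope k R u =
      ∫ u in (1 : ℝ)..M, tailEnvelope k R u := by
    rw [← intervalIntegral.integral_comp_neg]
    refine intervalIntegral.integral_congr fun u _ => ?_
    simp [tailEnvelope]
  have hmid : ∫ u in (-1 : ℝ)..1, tailEnvelope k R u = 2 := by
    rw [intervalIntegral.integral_congr (g := fun _ => (1 : ℝ)) fun u hu => ?_]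
    · norm_num
    · rw [Set.uIcc_of_le (by norm_num)] at hu
      have hu1 : |u| ≤ 1 := abs_le.2 hu
      rw [tailEnvelope_eq hk hR (hu1.trans hM), max_eq_left hu1, Real.one_rpow]
  rw [envelopeMass, integral_Icc_eq_integral_Ioc,
    ← intervalIntegral.integral_of_le (by linarith),
    ← intervalIntegral.integral_add_adjacent_intervals (hint (-M) (-1)) (hint (-1) M),
    ← intervalIntegral.integral_add_adjacent_intervals (hint (-1) 1) (hint 1 M), hneg, hmid, hpos]
  ring

theorem envelopeMass_le_log (hk : 2 < k) (hR : 1 ≤ R) :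
    envelopeMass k R ≤ 2 + 2 * Real.log R := by
  have hM := one_le_truncation hk hR
  have hlog : ∫ u in (1 : ℝ)..truncation k R, u ^ (-(k / 2)) ≤ Real.log (truncation k R) := by
    calc ∫ u in (1 : ℝ)..truncation k R, u ^ (-(k / 2))
        ≤ ∫ u in (1 : ℝ)..truncation k R, u⁻¹ := by
          refine intervalIntegral.integral_mono_on hM ?_ ?_ fun u hu => ?_
          · refine intervalIntegral.intervalIntegrable_rpow (Or.inr ?_)
            rw [Set.uIcc_of_le hM]; exact fun h => by linarith [h.1]
          · refine intervalIntegral.intervalIntegrable_inv (fun u hu => ?_) continuousOn_id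
            rw [Set.uIcc_of_le hM] at hu; exact (by linarith [hu.1] : (0 : ℝ) < u).ne'
          · rw [← Real.rpow_neg_one]
            exact Real.rpow_le_rpow_of_exponent_le hu.1 (by linarith)
      _ = Real.log (truncation k R) := by
          rw [integral_inv (by rw [Set.uIcc_of_le hM]; exact fun h => by linarith [h.1]), div_one]
  have hM' : Real.log (truncation k R) ≤ Real.log R := by
    rw [truncation, Real.log_rpow (by linarith)]
    have h2k : 2 / k ≤ 1 := (div_le_one (by linarith)).2 hk.le
    nlinarith [Real.log_nonneg hR]
  rw [envelopeMass_eq hk hR]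
  linarith

theorem envelopeMass_le_inv (hk : 2 < k) (hR : 1 ≤ R) :
    envelopeMass k R ≤ 2 + 2 * (k / 2 - 1)⁻¹ := by
  have hM := one_le_truncation hk hR
  rw [envelopeMass_eq hk hR, integral_rpow (Or.inr ⟨by linarith, by
    rw [Set.uIcc_of_le hM]; exact fun h => by linarith [h.1]⟩), Real.one_rpow]
  have h1 : (truncation k R ^ (-(k / 2) + 1) - 1) / (-(k / 2) + 1) =
      (1 - truncation k R ^ (-(k / 2) + 1)) * (k / 2 - 1)⁻¹ := by
    rw [← neg_div_neg_eq, div_eq_mul_inv]; congr 2 <;> ring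
  rw [h1]
  have h2 : 0 ≤ truncation k R ^ (-(k / 2) + 1) := by positivity
  have h3 : 0 < (k / 2 - 1)⁻¹ := inv_pos.2 (by linarith)
  nlinarith

theorem integral_thresholdLaw (hk : 2 < k) (hR : 1 ≤ R) (f : ℝ → ℝ) :
    ∫ u, f u ∂thresholdLaw k R = ∫ u in Set.Icc (-truncation k R) (truncation k R),
      tailEnvelope k R u / envelopeMass k R * f u := by
  have hS := two_le_envelopeMass hk hR
  rw [thresholdLaw, integral_withDensity_eq_integral_toReal_smul
    ((measurable_tailEnvelope k R).div_const _).ennreal_ofReal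
    (Filter.Eventually.of_forall fun u => ENNReal.ofReal_lt_top)]
  refine integral_congr_ae (Filter.Eventually.of_forall fun u => ?_)
  simp only
  rw [ENNReal.toReal_ofReal (div_nonneg (tailEnvelope_pos hR u).le (by linarith)), smul_eq_mul]

theorem isProbabilityMeasure_thresholdLaw (hk : 2 < k) (hR : 1 ≤ R) :
    IsProbabilityMeasure (thresholdLaw k R) := by
  have hS := two_le_envelopeMass hk hR
  constructor
  rw [thresholdLaw, withDensity_apply _ MeasurableSet.univ, Measure.restrict_univ,
    ← ofReal_integral_eq_lintegral_ofReal
      ((integrable_tailEnvelope hk hR _).div_const _)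
      (Filter.Eventually.of_forall fun u => div_nonneg (tailEnvelope_pos hR u).le (by linarith)),
    integral_div]
  change ENNReal.ofReal (envelopeMass k R / envelopeMass k R) = 1
  rw [div_self (by linarith), ENNReal.ofReal_one]

theorem abs_weightedBit_le (hk : 2 < k) (hR : 1 ≤ R) (u y : ℝ) :
    |weightedBit k R u y| ≤ envelopeMass k R * R := by
  have hS := two_le_envelopeMass hk hR
  have hg := tailEnvelope_pos (k := k) hR u
  rw [weightedBit, abs_mul, abs_of_nonneg (div_nonneg (by linarith) hg.le), div_eq_mul_inv,
    mul_assoc]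
  refine mul_le_mul_of_nonneg_left ?_ (by linarith)
  have h1 : (tailEnvelope k R u)⁻¹ ≤ R := inv_le_of_inv_le₀ (by linarith) (inv_le_tailEnvelope u)
  calc (tailEnvelope k R u)⁻¹ * |crossing u y| ≤ R * 1 :=
        mul_le_mul h1 (abs_crossing_le_one u y) (abs_nonneg _) (by linarith)
    _ = R := mul_one R

theorem integral_weightedBit (hk : 2 < k) (hR : 1 ≤ R) (D : Measure ℝ) [IsProbabilityMeasure D] :
    ∫ p, weightedBit k R p.1 p.2 ∂((thresholdLaw k R).prod D) =
      ∫ y, max (-truncation k R) (min (truncation k R) y) ∂D := by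
  have := isProbabilityMeasure_thresholdLaw hk hR
  have hS := two_le_envelopeMass hk hR
  have hM := one_le_truncation hk hR
  rw [integral_prod_symm _ (integrable_of_bounded (measurable_weightedBit k R)
    fun p => abs_weightedBit_le hk hR p.1 p.2)]
  refine integral_congr_ae (Filter.Eventually.of_forall fun y => ?_)
  simp only
  rw [integral_thresholdLaw hk hR, ← setIntegral_crossing (by linarith) y]
  refine integral_congr_ae (Filter.Eventually.of_forall fun u => ?_)
  have hg := tailEnvelope_pos (k := k) hR u
  simp only [weightedBit]
  field_simp

/-- The density is the square root of the tail bound, so the second moment of the weighted bit is at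
most the square of the normalising constant. -/
theorem integral_weightedBit_sq_le (hk : 2 < k) (hR : 1 ≤ R) (D : Measure ℝ)
    [IsProbabilityMeasure D] (hD : ∀ u : ℝ, D.real {y | |u| ≤ |y|} ≤ max 1 |u| ^ (-k)) :
    ∫ p, weightedBit k R p.1 p.2 ^ 2 ∂((thresholdLaw k R).prod D) ≤ envelopeMass k R ^ 2 := by
  have := isProbabilityMeasure_thresholdLaw hk hR
  have hmeas : Measurable fun p : ℝ × ℝ => weightedBit k R p.1 p.2 ^ 2 :=
    (measurable_weightedBit k R).pow_const 2
  have hint : Integrable (fun p : ℝ × ℝ => weightedBit k R p.1 p.2 ^ 2)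
      ((thresholdLaw k R).prod D) := by
    refine integrable_of_bounded hmeas (B := (envelopeMass k R * R) ^ 2) fun p => ?_
    rw [abs_pow]
    exact pow_le_pow_left₀ (abs_nonneg _) (abs_weightedBit_le hk hR p.1 p.2) 2
  rw [integral_prod _ hint]
  calc ∫ u, ∫ y, weightedBit k R u y ^ 2 ∂D ∂thresholdLaw k R
      ≤ ∫ _u, envelopeMass k R ^ 2 ∂thresholdLaw k R := by
        refine integral_mono hint.integral_prod_left (integrable_const _) fun u => ?_
        have hg := tailEnvelope_pos (k := k) hR u
        have hset : MeasurableSet {y : ℝ | |u| ≤ |y|} :=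
          measurableSet_le measurable_const continuous_abs.measurable
        have h1 : ∫ y, crossing u y ^ 2 ∂D ≤ tailEnvelope k R u ^ 2 := by
          calc ∫ y, crossing u y ^ 2 ∂D
              ≤ ∫ y, Set.indicator {z : ℝ | |u| ≤ |z|} (fun _ => 1) y ∂D := by
                refine integral_mono ?_ ((integrable_const _).indicator hset)
                  fun y => crossing_sq_le u y
                refine integrable_of_bounded (B := 1) ?_ fun y => ?_
                · exact (measurable_crossing.comp measurable_prodMk_left).pow_const 2
                · rw [abs_pow]; exact pow_le_one₀ (abs_nonneg _) (abs_crossing_le_one u y)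
            _ = D.real {y | |u| ≤ |y|} := by
                rw [integral_indicator hset]; simp
            _ ≤ max 1 |u| ^ (-k) := hD u
            _ = (max 1 |u| ^ (-(k / 2))) ^ 2 := by
                rw [← Real.rpow_natCast, ← Real.rpow_mul (by positivity)]
                congr 1; push_cast; ring
            _ ≤ tailEnvelope k R u ^ 2 :=
                pow_le_pow_left₀ (by positivity) (le_max_right _ _) 2
        simp only [weightedBit, mul_pow]
        rw [integral_const_mul, div_pow]
        calc envelopeMass k R ^ 2 / tailEnvelope k R u ^ 2 * ∫ y, crossing u y ^ 2 ∂D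
            ≤ envelopeMass k R ^ 2 / tailEnvelope k R u ^ 2 * tailEnvelope k R u ^ 2 := by
              gcongr
          _ = envelopeMass k R ^ 2 := by field_simp
    _ = envelopeMass k R ^ 2 := by simp

theorem abs_clip_sub_le (hk : 2 < k) (hR : 1 ≤ R) (y : ℝ) :
    |max (-truncation k R) (min (truncation k R) y) - y| ≤ R⁻¹ * |y| ^ k := by
  have hM := one_le_truncation hk hR
  set M := truncation k R with hMdef
  rcases le_or_gt |y| M with hy | hy
  · obtain ⟨h1, h2⟩ := abs_le.1 hy
    rw [min_eq_right h2, max_eq_right h1, sub_self, abs_zero]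
    positivity
  · have hy0 : 0 < |y| := by linarith
    have h1 : |max (-M) (min M y) - y| ≤ |y| := by
      rcases lt_abs.1 hy with h | h
      · rw [min_eq_left h.le, max_eq_right (by linarith), abs_of_neg (by linarith)]
        linarith [le_abs_self y]
      · rw [min_eq_right (by linarith), max_eq_left (by linarith), abs_of_pos (by linarith)]
        linarith [neg_le_abs y]
    have h2 : R ≤ |y| ^ (k - 1) := by
      calc R = M ^ (k / 2) := (truncation_rpow_half hk hR).symm
        _ ≤ M ^ (k - 1) := Real.rpow_le_rpow_of_exponent_le hM (by linarith)
        _ ≤ |y| ^ (k - 1) := Real.rpow_le_rpow (by linarith) hy.le (by linarith)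
    have h3 : |y| ^ k = |y| ^ (k - 1) * |y| := by
      rw [← Real.rpow_add_one hy0.ne']; congr 1; ring
    calc _ ≤ |y| := h1
      _ = R⁻¹ * (R * |y|) := by field_simp
      _ ≤ R⁻¹ * |y| ^ k := by
          rw [h3]; gcongr

theorem abs_integral_weightedBit_sub_le (hk : 2 < k) (hR : 1 ≤ R) (D : Measure ℝ)
    [IsProbabilityMeasure D] (hD1 : Integrable (fun y : ℝ => y) D)
    (hDk : Integrable (fun y : ℝ => |y| ^ k) D) (hD : ∫ y, |y| ^ k ∂D ≤ 1) :
    |∫ p, weightedBit k R p.1 p.2 ∂((thresholdLaw k R).prod D) - ∫ y, y ∂D| ≤ R⁻¹ := by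
  have hM := one_le_truncation hk hR
  have hclip : Integrable (fun y => max (-truncation k R) (min (truncation k R) y)) D := by
    refine integrable_of_bounded (by fun_prop) (B := truncation k R) fun y => ?_
    exact abs_le.2 ⟨le_max_left _ _, max_le (by linarith) (min_le_left _ _)⟩
  rw [integral_weightedBit hk hR, ← integral_sub hclip hD1]
  calc |∫ y, (max (-truncation k R) (min (truncation k R) y) - y) ∂D|
      ≤ ∫ y, |max (-truncation k R) (min (truncation k R) y) - y| ∂D := abs_integral_le_integral_abs
    _ ≤ ∫ y, R⁻¹ * |y| ^ k ∂D :=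
        integral_mono (hclip.sub hD1).abs (hDk.const_mul _) fun y => abs_clip_sub_le hk hR y
    _ ≤ R⁻¹ := by
        rw [integral_const_mul]
        exact mul_le_of_le_one_right (by positivity) hD

end

/-! ### Locating the mean by a random code on cells -/

/-- The index of the cell of `x`, for the `m + 1` cells of width `w` that start at `-lam`. Points
left of `-lam` belong to the first cell and points beyond the last cell belong to the last. -/
noncomputable def cellIndex (m : ℕ) (lam w x : ℝ) : Fin (m + 1) :=
  ⟨min m ⌊(x + lam) / w⌋₊, by omega⟩

/-- The left end of the cell with index `j`. -/
noncomputable def cellPoint {m : ℕ} (lam w : ℝ) (j : Fin (m + 1)) : ℝ := -lam + (j : ℕ) * w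

theorem measurable_cellIndex (m : ℕ) (lam w : ℝ) : Measurable (cellIndex m lam w) := by
  have h : Measurable fun x : ℝ => ⌊(x + lam) / w⌋₊ :=
    Nat.measurable_floor.comp (by fun_prop)
  exact (Measurable.of_discrete (f := fun i : ℕ => (⟨min m i, by omega⟩ : Fin (m + 1)))).comp h

theorem cellIndex_cellPoint {m : ℕ} {lam w : ℝ} (hw : 0 < w) (j : Fin (m + 1)) :
    cellIndex m lam w (cellPoint lam w j) = j := by
  ext
  simp only [cellIndex, cellPoint]
  rw [show (-lam + (j : ℕ) * w + lam) / w = (j : ℕ) by field_simp; ring, Nat.floor_natCast]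
  omega

theorem abs_cellPoint_cellIndex_sub_le {m : ℕ} {lam σ μ x : ℝ} (hσ : 0 < σ)
    (hμ : μ ∈ Set.Icc (-lam) lam) (hm : lam ≤ m * σ) (hx : |x - μ| ≤ 3 * σ) :
    |cellPoint lam (6 * σ) (cellIndex m lam (6 * σ) x) - μ| ≤ 9 * σ := by
  obtain ⟨hx1, hx2⟩ := abs_le.1 hx
  obtain ⟨hμ1, hμ2⟩ := hμ
  simp only [cellPoint, cellIndex]
  set a := (x + lam) / (6 * σ) with ha
  have hxa : x = a * (6 * σ) - lam := by rw [ha]; field_simp; ring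
  rcases le_or_gt m ⌊a⌋₊ with h | h
  · rw [min_eq_left h]
    rcases Nat.eq_zero_or_pos m with h0 | h0
    · subst h0
      rw [Nat.cast_zero, zero_mul] at *
      rw [abs_le]; constructor <;> linarith
    · have hma : (m : ℝ) ≤ a := (Nat.le_floor_iff' h0.ne').1 h
      have : (m : ℝ) * (6 * σ) ≤ a * (6 * σ) := by gcongr
      rw [abs_le]
      constructor <;> nlinarith
  · rw [min_eq_right h.le]
    have h1 : a < ⌊a⌋₊ + 1 := Nat.lt_floor_add_one a
    have h2 : a * (6 * σ) ≤ (⌊a⌋₊ + 1) * (6 * σ) := by gcongr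
    rcases le_or_gt 0 a with h0 | h0
    · have h3 : (⌊a⌋₊ : ℝ) * (6 * σ) ≤ a * (6 * σ) := by gcongr; exact Nat.floor_le h0
      rw [abs_le]; constructor <;> linarith
    · rw [Nat.floor_of_nonpos h0.le] at *
      have h3 : a * (6 * σ) ≤ 0 := mul_nonpos_of_nonpos_of_nonneg h0.le (by linarith)
      rw [Nat.cast_zero, zero_mul, abs_le]; constructor <;> linarith

/-- An interval as long as a cell meets at most two cells. -/
theorem cellIndex_eq_or {m : ℕ} {lam w a x : ℝ} (hw : 0 < w) (hx1 : a ≤ x) (hx2 : x ≤ a + w) :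
    cellIndex m lam w x = cellIndex m lam w a ∨
      cellIndex m lam w x = cellIndex m lam w (a + w) := by
  have h1 : ⌊(a + lam) / w⌋₊ ≤ ⌊(x + lam) / w⌋₊ := Nat.floor_mono (by gcongr)
  have h2 : ⌊(x + lam) / w⌋₊ ≤ ⌊(a + w + lam) / w⌋₊ := Nat.floor_mono (by gcongr)
  have h3 : ⌊(a + w + lam) / w⌋₊ ≤ ⌊(a + lam) / w⌋₊ + 1 := by
    rw [show (a + w + lam) / w = (a + lam) / w + 1 by field_simp; ring]
    refine Nat.lt_succ_iff.1 ((Nat.floor_lt' (by omega)).2 ?_)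
    push_cast
    linarith [Nat.lt_floor_add_one ((a + lam) / w)]
  simp only [cellIndex, Fin.mk.injEq]
  omega

theorem card_near_cells_le {m : ℕ} {lam σ μ : ℝ} (hσ : 0 < σ) (s : Finset (Fin (m + 1)))
    (hs : ∀ j ∈ s, |cellPoint lam (6 * σ) j - μ| ≤ 9 * σ) : s.card ≤ 4 := by
  rcases s.eq_empty_or_nonempty with rfl | hne
  · simp
  have hsub : s.map Fin.valEmbedding ⊆
      Finset.Icc (s.min' hne : ℕ) ((s.min' hne : ℕ) + 3) := by
    intro i hi
    obtain ⟨j, hj, rfl⟩ := Finset.mem_map.1 hi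
    have hle : s.min' hne ≤ j := s.min'_le j hj
    have h1 := (abs_le.1 (hs j hj)).2
    have h2 := (abs_le.1 (hs _ (s.min'_mem hne))).1
    simp only [cellPoint] at h1 h2
    refine Finset.mem_Icc.2 ⟨hle, ?_⟩
    have h3 : ((j : ℕ) : ℝ) ≤ ((s.min' hne : ℕ) : ℝ) + 3 := by
      by_contra! hcon
      nlinarith
    exact_mod_cast h3
  have := Finset.card_le_card hsub
  rw [Finset.card_map, Nat.card_Icc] at this
  omega

/-- The law of a uniformly random colouring of the cells by two colours. -/
noncomputable def codeLaw (m : ℕ) : Measure (Fin (m + 1) → Bool) :=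
  (PMF.uniformOfFintype (Fin (m + 1) → Bool)).toMeasure

instance (m : ℕ) : IsProbabilityMeasure (codeLaw m) := by
  unfold codeLaw; infer_instance

theorem integral_codeLaw_eq {m : ℕ} (i j : Fin (m + 1)) :
    ∫ b, (if b i = b j then (1 : ℝ) else 0) ∂codeLaw m = if i = j then 1 else 1 / 2 := by
  split_ifs with hij
  · simp [hij]
  -- recolouring cell `i` exchanges agreement with disagreement
  let flip : (Fin (m + 1) → Bool) → (Fin (m + 1) → Bool) := fun b => Function.update b i (!b i)
  have hflip : Function.Involutive flip := fun b => by
    simp [flip]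
  have hsum : ∑ b : Fin (m + 1) → Bool, (if b i = b j then (1 : ℝ) else 0) =
      ∑ b : Fin (m + 1) → Bool, (1 - if b i = b j then (1 : ℝ) else 0) := by
    refine Fintype.sum_equiv hflip.toPerm _ _ fun b => ?_
    have h1 : flip b i = !b i := by simp [flip]
    have h2 : flip b j = b j := by simp [flip, Ne.symm hij]
    change _ = (1 - if flip b i = flip b j then (1 : ℝ) else 0)
    rw [h1, h2]
    cases b i <;> cases b j <;> simp
  rw [codeLaw, PMF.integral_eq_sum]
  simp only [PMF.uniformOfFintype_apply, smul_eq_mul]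
  rw [← Finset.mul_sum]
  rw [Finset.sum_sub_distrib] at hsum
  simp only [Finset.sum_const, Finset.card_univ, nsmul_eq_mul, mul_one] at hsum
  have hcard : (0 : ℝ) < Fintype.card (Fin (m + 1) → Bool) := by exact_mod_cast Fintype.card_pos
  have hval : ∑ b : Fin (m + 1) → Bool, (if b i = b j then (1 : ℝ) else 0) =
      Fintype.card (Fin (m + 1) → Bool) / 2 := by linarith
  rw [hval, ENNReal.toReal_inv, ENNReal.toReal_natCast]
  field_simp

/-- Whether, in a round with code `p.1.1` and sample `p.2`, the cell of the sample has the same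
colour as cell `j`. The component `p.1.2`, a random threshold, plays no part. -/
noncomputable def agreement {m : ℕ} (lam w : ℝ) (j : Fin (m + 1))
    (p : ((Fin (m + 1) → Bool) × ℝ) × ℝ) : ℝ :=
  if p.1.1 (cellIndex m lam w p.2) = p.1.1 j then 1 else 0

theorem measurable_color_eq {m : ℕ} (lam w : ℝ) (j : Fin (m + 1)) :
    MeasurableSet {p : (Fin (m + 1) → Bool) × ℝ | p.1 (cellIndex m lam w p.2) = p.1 j} := by
  have h : Measurable fun p : (Fin (m + 1) → Bool) × ℝ => (p.1, cellIndex m lam w p.2) :=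
    measurable_fst.prodMk ((measurable_cellIndex m lam w).comp measurable_snd)
  exact h (MeasurableSet.of_discrete
    (s := {q : (Fin (m + 1) → Bool) × Fin (m + 1) | q.1 q.2 = q.1 j}))

theorem measurable_agreement {m : ℕ} (lam w : ℝ) (j : Fin (m + 1)) :
    Measurable (agreement lam w j) := by
  have h : Measurable fun p : ((Fin (m + 1) → Bool) × ℝ) × ℝ => (p.1.1, p.2) := by fun_prop
  exact Measurable.ite (h (measurable_color_eq lam w j)) measurable_const measurable_const

theorem abs_agreement_le {m : ℕ} (lam w : ℝ) (j : Fin (m + 1))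
    (p : ((Fin (m + 1) → Bool) × ℝ) × ℝ) : |agreement lam w j p| ≤ 1 := by
  unfold agreement; split_ifs <;> simp

theorem integral_agreement {m : ℕ} (lam w : ℝ) (j : Fin (m + 1)) (ν D : Measure ℝ)
    [IsProbabilityMeasure ν] [IsProbabilityMeasure D] :
    ∫ p, agreement lam w j p ∂(((codeLaw m).prod ν).prod D) =
      (1 + D.real {x | cellIndex m lam w x = j}) / 2 := by
  have hset : MeasurableSet {x | cellIndex m lam w x = j} :=
    measurable_cellIndex m lam w (measurableSet_singleton j)
  rw [integral_prod_symm _ (integrable_of_bounded (measurable_agreement lam w j)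
    (abs_agreement_le lam w j))]
  have hinner : ∀ x, ∫ q, agreement lam w j (q, x) ∂((codeLaw m).prod ν) =
      1 / 2 + {x | cellIndex m lam w x = j}.indicator (fun _ => (1 / 2 : ℝ)) x := fun x => by
    have := integral_comp_of_measurePreserving
      (measurePreserving_fst (μ := codeLaw m) (ν := ν))
      (f := fun b => if b (cellIndex m lam w x) = b j then (1 : ℝ) else 0) Measurable.of_discrete
    simp only [agreement]
    rw [this, integral_codeLaw_eq]
    by_cases h : cellIndex m lam w x = j
    · rw [Set.indicator_of_mem (show x ∈ {x | cellIndex m lam w x = j} from h), if_pos h]; norm_num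
    · rw [Set.indicator_of_notMem (show x ∉ {x | cellIndex m lam w x = j} from h), if_neg h]
      norm_num
  simp only [hinner]
  rw [integral_add (integrable_const _) ((integrable_const _).indicator hset),
    integral_indicator hset]
  simp
  ring

/-- If all empirical agreements are accurate to within `1 / 18`, then the cell that agrees most
often is near the mean. One of the two cells around the mean has mass at least `4 / 9`, so the
best cell has mass more than `2 / 9`, more than the tail outside `[μ - 3 * σ, μ + 3 * σ]`. -/
theorem abs_cellPoint_sub_le_of_agreement {m T : ℕ} {lam σ μ : ℝ} (hσ : 0 < σ)
    (hμ : μ ∈ Set.Icc (-lam) lam) (hm : lam ≤ m * σ) (D : Measure ℝ) [IsProbabilityMeasure D]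
    (hD : D.real {x | 3 * σ ≤ |x - μ|} ≤ 1 / 9) {A : Fin (m + 1) → ℝ}
    (hA : ∀ j, |A j - T * ((1 + D.real {x | cellIndex m lam (6 * σ) x = j}) / 2)| <
      T * (1 / 18)) {i : Fin (m + 1)} (hi : ∀ j, A j ≤ A i) :
    |cellPoint lam (6 * σ) i - μ| ≤ 9 * σ := by
  have hT : (0 : ℝ) < T := by
    have := (abs_nonneg _).trans_lt (hA i)
    linarith
  set q : Fin (m + 1) → ℝ := fun j => D.real {x | cellIndex m lam (6 * σ) x = j}
  have hset : MeasurableSet {x : ℝ | 3 * σ ≤ |x - μ|} :=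
    measurableSet_le measurable_const (by fun_prop)
  have hqi : ∀ j, q j < q i + 2 / 9 := fun j => by
    have h1 := (abs_lt.1 (hA j)).1
    have h2 := (abs_lt.1 (hA i)).2
    have h3 : (T : ℝ) * q j < T * (q i + 2 / 9) := by
      simp only [q]; nlinarith [hi j]
    exact lt_of_mul_lt_mul_left h3 hT.le
  have hcover : 8 / 9 ≤ q (cellIndex m lam (6 * σ) (μ - 3 * σ)) +
      q (cellIndex m lam (6 * σ) (μ - 3 * σ + 6 * σ)) := by
    have h1 : D.real {x | 3 * σ ≤ |x - μ|}ᶜ = 1 - D.real {x | 3 * σ ≤ |x - μ|} :=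
      probReal_compl_eq_one_sub hset
    have h2 : D.real {x | 3 * σ ≤ |x - μ|}ᶜ ≤ q (cellIndex m lam (6 * σ) (μ - 3 * σ)) +
        q (cellIndex m lam (6 * σ) (μ - 3 * σ + 6 * σ)) := by
      refine le_trans (measureReal_mono ?_) (measureReal_union_le _ _)
      intro x hx
      have hx' : |x - μ| < 3 * σ := not_le.1 hx
      obtain ⟨h3, h4⟩ := abs_lt.1 hx'
      exact cellIndex_eq_or (by linarith) (by linarith) (by linarith)
    linarith
  by_contra hcon
  have hqle : q i ≤ 1 / 9 := by
    refine le_trans (measureReal_mono fun x hx => ?_) hD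
    by_contra hx'
    have hx3 : |x - μ| < 3 * σ := not_le.1 hx'
    have h4 := abs_cellPoint_cellIndex_sub_le hσ hμ hm hx3.le
    rw [show cellIndex m lam (6 * σ) x = i from hx] at h4
    exact hcon h4
  linarith [hqi (cellIndex m lam (6 * σ) (μ - 3 * σ)),
    hqi (cellIndex m lam (6 * σ) (μ - 3 * σ + 6 * σ))]

/-! ### The two-stage protocol -/

theorem transcript_length {S : Type} (query : S → List Round → (ℝ → Bool)) (s : S) :
    ∀ (t : ℕ) (x : Fin t → ℝ), (transcript query s t x).length = t
  | 0, _ => rfl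
  | t + 1, x => by simp [transcript, transcript_length query s t]

/-- The query of the first stage: the colour of the cell of the sample. -/
noncomputable def codeQuery {m : ℕ} (lam w : ℝ) (b : Fin (m + 1) → Bool) : ℝ → Bool :=
  fun x => b (cellIndex m lam w x)

/-- The query of the second stage: whether the sample exceeds `θ`. -/
noncomputable def thresholdQuery (θ : ℝ) : ℝ → Bool := fun x => decide (θ < x)

/-- The number of rounds of `h` in which the query, evaluated at the left end of cell `j`, equals
the bit received. -/
noncomputable def score (m : ℕ) (lam w : ℝ) (h : List Round) (j : Fin (m + 1)) : ℕ :=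
  (h.map fun r => if r.1 (cellPoint lam w j) = r.2 then 1 else 0).sum

/-- A maximiser of `v`. -/
noncomputable def argmax {m : ℕ} (v : Fin (m + 1) → ℕ) : Fin (m + 1) :=
  (Finite.exists_max v).choose

theorem le_argmax {m : ℕ} (v : Fin (m + 1) → ℕ) (j : Fin (m + 1)) : v j ≤ v (argmax v) :=
  (Finite.exists_max v).choose_spec j

/-- The first-stage estimate of the mean: the cell with the best score over the first `T` rounds. -/
noncomputable def coarse (m T : ℕ) (lam w : ℝ) (h : List Round) : ℝ :=
  cellPoint lam w (argmax (score m lam w (h.take T)))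

/-- The query strategy: `T` random colours of cells, then random thresholds at scale `ρ` around
the first-stage estimate. The seed holds one code and one threshold for every round. -/
noncomputable def twoStageQuery (m T n : ℕ) (lam w ρ : ℝ)
    (s : Fin n → (Fin (m + 1) → Bool) × ℝ) (h : List Round) : ℝ → Bool :=
  if hn : h.length < n then
    if h.length < T then codeQuery lam w (s ⟨h.length, hn⟩).1
    else thresholdQuery (coarse m T lam w h + ρ * (s ⟨h.length, hn⟩).2)
  else fun _ => false

/-- The weighted bit of a second-stage round, for the first-stage estimate `c`. The threshold is read
off the query as the infimum of the points that it accepts. -/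
noncomputable def roundValue (k R ρ c : ℝ) (r : Round) : ℝ :=
  let u := (sInf {x | r.1 x = true} - c) / ρ
  envelopeMass k R / tailEnvelope k R u * ((if r.2 then 1 else 0) - if u < 0 then 1 else 0)

/-- The estimation rule: the first-stage estimate, corrected by the average weighted bit. -/
noncomputable def twoStageEstimate (m T N : ℕ) (lam w ρ k R : ℝ) (h : List Round) : ℝ :=
  coarse m T lam w h +
    ρ * (((h.drop T).map (roundValue k R ρ (coarse m T lam w h))).sum / N)

theorem roundValue_threshold {k R ρ : ℝ} (hρ : 0 < ρ) (c u x : ℝ) :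
    roundValue k R ρ c (thresholdQuery (c + ρ * u), thresholdQuery (c + ρ * u) x) =
      weightedBit k R u ((x - c) / ρ) := by
  have h1 : {y : ℝ | thresholdQuery (c + ρ * u) y = true} = Set.Ioi (c + ρ * u) := by
    ext y; simp [thresholdQuery]
  have h2 : (c + ρ * u - c) / ρ = u := by field_simp; ring
  have h3 : (c + ρ * u < x) ↔ u < (x - c) / ρ := by
    rw [lt_div_iff₀ hρ]; constructor <;> intro h <;> linarith
  simp only [roundValue, h1, csInf_Ioi, h2]
  simp only [weightedBit, crossing, thresholdQuery, decide_eq_true_eq, h3]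

section

variable {m T N : ℕ} {lam w ρ : ℝ}

theorem transcript_first_stage {n t : ℕ} (ht : t ≤ T) (hTn : T ≤ n)
    (s : Fin n → (Fin (m + 1) → Bool) × ℝ) (x : Fin t → ℝ) :
    transcript (twoStageQuery m T n lam w ρ) s t x =
      List.ofFn fun i : Fin t => (codeQuery lam w (s (Fin.castLE (ht.trans hTn) i)).1,
        codeQuery lam w (s (Fin.castLE (ht.trans hTn) i)).1 (x i)) := by
  induction t with
  | zero => simp [transcript]
  | succ t ih =>
    have hq : twoStageQuery m T n lam w ρ s
        (transcript (twoStageQuery m T n lam w ρ) s t (Fin.init x)) =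
        codeQuery lam w (s (Fin.castLE (ht.trans hTn) (Fin.last t))).1 := by
      unfold twoStageQuery
      have hl := transcript_length (twoStageQuery m T n lam w ρ) s t (Fin.init x)
      unfold twoStageQuery at hl
      rw [dif_pos (by omega), if_pos (by omega)]
      congr 3
      ext
      exact hl
    rw [transcript]
    rw [hq, ih (by omega), List.ofFn_succ', List.concat_eq_append]
    rfl

/-- The index of the cell found by the first stage, as a function of the codes and samples of the first
`T` rounds. -/
noncomputable def center (m T : ℕ) (lam w : ℝ) (b : Fin T → (Fin (m + 1) → Bool))
    (x : Fin T → ℝ) : Fin (m + 1) :=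
  argmax fun j => ∑ i, if b i (cellIndex m lam w (x i)) = b i j then 1 else 0

theorem coarse_eq_of_take {n : ℕ} (hw : 0 < w) (hTn : T ≤ n)
    (s : Fin n → (Fin (m + 1) → Bool) × ℝ) (x : Fin T → ℝ) {h : List Round}
    (hh : h.take T = transcript (twoStageQuery m T n lam w ρ) s T x) :
    coarse m T lam w h =
      cellPoint lam w (center m T lam w (fun i => (s (Fin.castLE hTn i)).1) x) := by
  rw [coarse, hh, transcript_first_stage le_rfl hTn]
  congr 2
  funext j
  rw [score, List.map_ofFn, List.sum_ofFn]
  refine Finset.sum_congr rfl fun i _ => ?_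
  simp only [Function.comp, codeQuery, cellIndex_cellPoint hw]
  congr 1
  exact propext eq_comm

theorem transcript_second_stage {t : ℕ} (hw : 0 < w) (ht : t ≤ N)
    (s : Fin (T + N) → (Fin (m + 1) → Bool) × ℝ) (x : Fin (T + t) → ℝ) :
    let c := cellPoint lam w (center m T lam w (fun i => (s (Fin.castAdd N i)).1)
      fun i => x (Fin.castAdd t i))
    transcript (twoStageQuery m T (T + N) lam w ρ) s (T + t) x =
      transcript (twoStageQuery m T (T + N) lam w ρ) s T (fun i => x (Fin.castAdd t i)) ++
        List.ofFn fun i : Fin t =>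
          (thresholdQuery (c + ρ * (s (Fin.natAdd T (Fin.castLE ht i))).2),
            thresholdQuery (c + ρ * (s (Fin.natAdd T (Fin.castLE ht i))).2)
              (x (Fin.natAdd T i))) := by
  intro c
  induction t with
  | zero => simp
  | succ t ih =>
    have ih' := ih (by omega) (Fin.init x)
    have hx : (fun i => Fin.init (α := fun _ => ℝ) x (Fin.castAdd t i)) =
        fun i => x (Fin.castAdd (t + 1) i) := rfl
    simp only [hx] at ih'
    have hl := transcript_length (twoStageQuery m T (T + N) lam w ρ) s (T + t) (Fin.init x)
    have hc : coarse m T lam w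
        (transcript (twoStageQuery m T (T + N) lam w ρ) s (T + t) (Fin.init x)) = c := by
      refine coarse_eq_of_take (ρ := ρ) hw (Nat.le_add_right T N) s
        (fun i => x (Fin.castAdd (t + 1) i)) ?_
      rw [ih', List.take_left' (transcript_length _ _ _ _)]
    have hq : twoStageQuery m T (T + N) lam w ρ s
        (transcript (twoStageQuery m T (T + N) lam w ρ) s (T + t) (Fin.init x)) =
        thresholdQuery (c + ρ * (s (Fin.natAdd T (Fin.castLE ht (Fin.last t)))).2) := by
      rw [twoStageQuery, dif_pos (by omega), if_neg (by omega), hc]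
      congr 5
      ext
      exact hl
    change transcript (twoStageQuery m T (T + N) lam w ρ) s ((T + t) + 1) x = _
    rw [transcript]
    rw [hq, ih', List.ofFn_succ', List.concat_eq_append, List.append_assoc]
    rfl

theorem coarse_transcript {t : ℕ} (hw : 0 < w) (ht : t ≤ N)
    (s : Fin (T + N) → (Fin (m + 1) → Bool) × ℝ) (x : Fin (T + t) → ℝ) :
    coarse m T lam w (transcript (twoStageQuery m T (T + N) lam w ρ) s (T + t) x) =
      cellPoint lam w (center m T lam w (fun i => (s (Fin.castAdd N i)).1)
        fun i => x (Fin.castAdd t i)) := by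
  refine coarse_eq_of_take (ρ := ρ) hw (Nat.le_add_right T N) s
    (fun i => x (Fin.castAdd t i)) ?_
  rw [transcript_second_stage hw ht, List.take_left' (transcript_length _ _ _ _)]

theorem twoStageEstimate_transcript {k R : ℝ} (hw : 0 < w) (hρ : 0 < ρ)
    (s : Fin (T + N) → (Fin (m + 1) → Bool) × ℝ) (x : Fin (T + N) → ℝ) :
    let c := cellPoint lam w (center m T lam w (fun i => (s (Fin.castAdd N i)).1)
      fun i => x (Fin.castAdd N i))
    twoStageEstimate m T N lam w ρ k R
        (transcript (twoStageQuery m T (T + N) lam w ρ) s (T + N) x) =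
      c + ρ * ((∑ i : Fin N, weightedBit k R (s (Fin.natAdd T i)).2
        ((x (Fin.natAdd T i) - c) / ρ)) / N) := by
  intro c
  rw [twoStageEstimate, coarse_transcript hw le_rfl]
  change c + ρ * ((List.map (roundValue k R ρ c) _).sum / N) = _
  rw [transcript_second_stage hw le_rfl, List.drop_left' (transcript_length _ _ _ _),
    List.map_ofFn, List.sum_ofFn]
  congr 3
  refine Finset.sum_congr rfl fun i _ => ?_
  exact roundValue_threshold hρ c _ _

theorem measurable_center (m T : ℕ) (lam w : ℝ) :
    Measurable fun p : (Fin T → (Fin (m + 1) → Bool)) × (Fin T → ℝ) =>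
      center m T lam w p.1 p.2 := by
  have hv : Measurable fun p : (Fin T → (Fin (m + 1) → Bool)) × (Fin T → ℝ) =>
      fun j : Fin (m + 1) =>
        ∑ i, if p.1 i (cellIndex m lam w (p.2 i)) = p.1 i j then (1 : ℕ) else 0 := by
    refine measurable_pi_lambda _ fun j => Finset.measurable_sum _ fun i _ => ?_
    have h : Measurable fun p : (Fin T → (Fin (m + 1) → Bool)) × (Fin T → ℝ) =>
        (p.1 i, p.2 i) := by fun_prop
    exact Measurable.ite (h (measurable_color_eq lam w j)) measurable_const measurable_const
  exact (Measurable.of_discrete (f := argmax (m := m))).comp hv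

theorem measurable_cellPoint_center {d : ℕ} :
    Measurable fun p : (Fin (T + N) → (Fin (m + 1) → Bool) × ℝ) × (Fin (T + d) → ℝ) =>
      cellPoint lam w (center m T lam w (fun i => (p.1 (Fin.castAdd N i)).1)
        fun i => p.2 (Fin.castAdd d i)) := by
  have h1 : Measurable fun p : (Fin (T + N) → (Fin (m + 1) → Bool) × ℝ) × (Fin (T + d) → ℝ) =>
      ((fun i : Fin T => (p.1 (Fin.castAdd N i)).1), fun i : Fin T => p.2 (Fin.castAdd d i)) := by
    fun_prop
  have h2 := (Measurable.of_discrete (f := cellPoint (m := m) lam w)).comp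
    ((measurable_center m T lam w).comp h1)
  exact h2

theorem measurable_decide_lt {α : Type*} [MeasurableSpace α] {f g : α → ℝ} (hf : Measurable f)
    (hg : Measurable g) : Measurable fun a => decide (f a < g a) :=
  measurable_to_bool (by
    have : (fun a => decide (f a < g a)) ⁻¹' {true} = {a | f a < g a} := by
      ext a; simp
    rw [this]
    exact measurableSet_lt hf hg)

theorem measurable_twoStage_feedback (hw : 0 < w) {t : ℕ} (ht : t < T + N) :
    Measurable fun p : (Fin (T + N) → (Fin (m + 1) → Bool) × ℝ) × (Fin t → ℝ) × ℝ =>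
      twoStageQuery m T (T + N) lam w ρ p.1
        (transcript (twoStageQuery m T (T + N) lam w ρ) p.1 t p.2.1) p.2.2 := by
  rcases lt_or_ge t T with h | h
  · have heq : (fun p : (Fin (T + N) → (Fin (m + 1) → Bool) × ℝ) × (Fin t → ℝ) × ℝ =>
        twoStageQuery m T (T + N) lam w ρ p.1
          (transcript (twoStageQuery m T (T + N) lam w ρ) p.1 t p.2.1) p.2.2) =
        fun p => (p.1 ⟨t, ht⟩).1 (cellIndex m lam w p.2.2) := by
      funext p
      have hl := transcript_length (twoStageQuery m T (T + N) lam w ρ) p.1 t p.2.1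
      rw [twoStageQuery, dif_pos (by omega), if_pos (by omega), codeQuery]
      simp only [hl]
    rw [heq]
    have h1 : Measurable fun p : (Fin (T + N) → (Fin (m + 1) → Bool) × ℝ) × (Fin t → ℝ) × ℝ =>
        ((p.1 ⟨t, ht⟩).1, cellIndex m lam w p.2.2) :=
      (by fun_prop : Measurable fun p : (Fin (T + N) → (Fin (m + 1) → Bool) × ℝ) ×
        (Fin t → ℝ) × ℝ => (p.1 ⟨t, ht⟩).1).prodMk
        ((measurable_cellIndex m lam w).comp (by fun_prop))
    exact (Measurable.of_discrete
      (f := fun q : (Fin (m + 1) → Bool) × Fin (m + 1) => q.1 q.2)).comp h1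
  · obtain ⟨d, rfl⟩ := Nat.exists_eq_add_of_le h
    have heq : (fun p : (Fin (T + N) → (Fin (m + 1) → Bool) × ℝ) × (Fin (T + d) → ℝ) × ℝ =>
        twoStageQuery m T (T + N) lam w ρ p.1
          (transcript (twoStageQuery m T (T + N) lam w ρ) p.1 (T + d) p.2.1) p.2.2) =
        fun p => decide (cellPoint lam w (center m T lam w (fun i => (p.1 (Fin.castAdd N i)).1)
          fun i => p.2.1 (Fin.castAdd d i)) + ρ * (p.1 ⟨T + d, ht⟩).2 < p.2.2) := by
      funext p
      have hl := transcript_length (twoStageQuery m T (T + N) lam w ρ) p.1 (T + d) p.2.1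
      rw [twoStageQuery, dif_pos (by omega), if_neg (by omega), thresholdQuery,
        coarse_transcript hw (by omega)]
      simp only [hl]
    rw [heq]
    refine measurable_decide_lt (Measurable.add ?_ (by fun_prop)) (by fun_prop)
    have h1 : Measurable fun p : (Fin (T + N) → (Fin (m + 1) → Bool) × ℝ) ×
        (Fin (T + d) → ℝ) × ℝ => (p.1, p.2.1) := by fun_prop
    have h2 := (measurable_cellPoint_center (m := m) (lam := lam) (w := w)).comp h1
    exact h2

theorem measurable_twoStageEstimate {k R : ℝ} (hw : 0 < w) (hρ : 0 < ρ) :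
    Measurable fun p : (Fin (T + N) → (Fin (m + 1) → Bool) × ℝ) × (Fin (T + N) → ℝ) =>
      twoStageEstimate m T N lam w ρ k R
        (transcript (twoStageQuery m T (T + N) lam w ρ) p.1 (T + N) p.2) := by
  obtain ⟨c, hc, heq⟩ : ∃ c : (Fin (T + N) → (Fin (m + 1) → Bool) × ℝ) × (Fin (T + N) → ℝ) → ℝ,
      Measurable c ∧ ∀ p, twoStageEstimate m T N lam w ρ k R
        (transcript (twoStageQuery m T (T + N) lam w ρ) p.1 (T + N) p.2) = c p +
          ρ * ((∑ i : Fin N, weightedBit k R (p.1 (Fin.natAdd T i)).2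
            ((p.2 (Fin.natAdd T i) - c p) / ρ)) / N) :=
    ⟨_, measurable_cellPoint_center, fun p => twoStageEstimate_transcript hw hρ p.1 p.2⟩
  have hterm : ∀ i : Fin N, Measurable
      fun p : (Fin (T + N) → (Fin (m + 1) → Bool) × ℝ) × (Fin (T + N) → ℝ) =>
        weightedBit k R (p.1 (Fin.natAdd T i)).2 ((p.2 (Fin.natAdd T i) - c p) / ρ) := fun i => by
    have h1 : Measurable fun p : (Fin (T + N) → (Fin (m + 1) → Bool) × ℝ) × (Fin (T + N) → ℝ) =>
        ((p.1 (Fin.natAdd T i)).2, (p.2 (Fin.natAdd T i) - c p) / ρ) := by fun_prop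
    have h2 := (measurable_weightedBit k R).comp h1
    exact h2
  simp only [heq]
  fun_prop

end

/-- The two-stage estimator with `T` rounds in the first stage and `N` in the second. -/
noncomputable def twoStageEstimator (m T N : ℕ) {lam w ρ k R : ℝ} (hw : 0 < w) (hρ : 0 < ρ)
    (hk : 2 < k) (hR : 1 ≤ R) : Estimator (T + N) :=
  have := isProbabilityMeasure_thresholdLaw hk hR
  { Seed := Fin (T + N) → (Fin (m + 1) → Bool) × ℝ
    seedLaw := Measure.pi fun _ => (codeLaw m).prod (thresholdLaw k R)
    query := twoStageQuery m T (T + N) lam w ρ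
    estimate := twoStageEstimate m T N lam w ρ k R
    measurable_feedback := fun _ ht => measurable_twoStage_feedback hw ht
    measurable_estimate := measurable_twoStageEstimate hw hρ }

/-! ### Moments and tails -/

theorem measureReal_le_of_moment {D : Measure ℝ} [IsProbabilityMeasure D] {f : ℝ → ℝ} {k a B : ℝ}
    (hk : 0 < k) (ha : 0 < a) (hf : Integrable (fun x => |f x| ^ k) D)
    (hB : ∫ x, |f x| ^ k ∂D ≤ B) : D.real {x | a ≤ |f x|} ≤ B * a ^ (-k) := by
  have h1 := mul_meas_ge_le_integral_of_nonneg
    (Filter.Eventually.of_forall fun x => by positivity) hf (a ^ k)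
  have h2 : {x | a ^ k ≤ |f x| ^ k} = {x | a ≤ |f x|} := by
    ext x
    exact Real.rpow_le_rpow_iff ha.le (abs_nonneg _) hk
  rw [h2] at h1
  have h3 : 0 < a ^ k := by positivity
  rw [Real.rpow_neg ha.le, ← div_eq_mul_inv, le_div_iff₀ h3]
  linarith

theorem measureReal_le_max_rpow {D : Measure ℝ} [IsProbabilityMeasure D] {k : ℝ}
    (hk : 0 < k) (hf : Integrable (fun y : ℝ => |y| ^ k) D) (hD : ∫ y, |y| ^ k ∂D ≤ 1) (u : ℝ) :
    D.real {y | |u| ≤ |y|} ≤ max 1 |u| ^ (-k) := by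
  rcases le_or_gt |u| 1 with hu | hu
  · rw [max_eq_left hu, Real.one_rpow]
    exact measureReal_le_one
  · rw [max_eq_right hu.le]
    simpa using measureReal_le_of_moment (f := fun y => y) hk (by linarith) hf hD

theorem tail_le_of_mem_momentFamily {k lam σ : ℝ} (hk : 2 < k) (hσ : 0 < σ) {D : Measure ℝ}
    (hD : D ∈ momentFamily k lam σ) : D.real {x | 3 * σ ≤ |x - mean D|} ≤ 1 / 9 := by
  obtain ⟨hprob, -, -, hint, hmom⟩ := hD
  refine (measureReal_le_of_moment (by linarith) (by positivity) hint hmom).trans ?_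
  rw [Real.mul_rpow (by norm_num) hσ.le, mul_left_comm, ← Real.rpow_add hσ, add_neg_cancel,
    Real.rpow_zero, mul_one]
  calc (3 : ℝ) ^ (-k) ≤ 3 ^ (-2 : ℝ) := Real.rpow_le_rpow_of_exponent_le (by norm_num) (by linarith)
    _ = 1 / 9 := by rw [Real.rpow_neg (by norm_num)]; norm_num

/-- Recentring at a point within `9 * σ` of the mean, at scale `10 * σ`: Minkowski's inequality in
the form of the convexity of `x ^ k` with the weights `1 / 10` and `9 / 10`. -/
theorem abs_recentre_rpow_le {k σ μ c : ℝ} (hk : 2 < k) (hσ : 0 < σ) (hc : |c - μ| ≤ 9 * σ)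
    (x : ℝ) : |(x - c) / (10 * σ)| ^ k ≤ 1 / 10 * (|x - μ| / σ) ^ k + 9 / 10 := by
  have h1 : |(x - c) / (10 * σ)| ≤ 1 / 10 * (|x - μ| / σ) + 9 / 10 * 1 := by
    rw [abs_div, abs_of_pos (by positivity : 0 < 10 * σ), div_le_iff₀ (by positivity)]
    have h2 : |x - c| ≤ |x - μ| + |c - μ| := by
      rw [abs_sub_comm c μ]; exact abs_sub_le x μ c
    have h3 : (1 / 10 * (|x - μ| / σ) + 9 / 10 * 1) * (10 * σ) = |x - μ| + 9 * σ := by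
      field_simp
    linarith
  calc |(x - c) / (10 * σ)| ^ k ≤ (1 / 10 * (|x - μ| / σ) + 9 / 10 * 1) ^ k :=
        Real.rpow_le_rpow (abs_nonneg _) h1 (by linarith)
    _ ≤ 1 / 10 * (|x - μ| / σ) ^ k + 9 / 10 * 1 ^ k := by
        have := (convexOn_rpow (p := k) (by linarith)).2
          (show |x - μ| / σ ∈ Set.Ici (0 : ℝ) from by simp only [Set.mem_Ici]; positivity)
          (show (1 : ℝ) ∈ Set.Ici (0 : ℝ) from by simp)
          (show (0 : ℝ) ≤ 1 / 10 by norm_num) (show (0 : ℝ) ≤ 9 / 10 by norm_num) (by norm_num)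
        simpa only [smul_eq_mul] using this
    _ = _ := by rw [Real.one_rpow, mul_one]

theorem recentred_moment {k lam σ c : ℝ} (hk : 2 < k) (hσ : 0 < σ) {D : Measure ℝ}
    (hD : D ∈ momentFamily k lam σ) (hc : |c - mean D| ≤ 9 * σ) :
    Integrable (fun x => |(x - c) / (10 * σ)| ^ k) D ∧
      ∫ x, |(x - c) / (10 * σ)| ^ k ∂D ≤ 1 := by
  obtain ⟨hprob, -, -, hint, hmom⟩ := hD
  have hdiv : ∀ x, (|x - mean D| / σ) ^ k = |x - mean D| ^ k / σ ^ k := fun x =>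
    Real.div_rpow (abs_nonneg _) hσ.le k
  have hbd : Integrable (fun x => 1 / 10 * (|x - mean D| / σ) ^ k + 9 / 10) D := by
    simp only [hdiv]
    exact ((hint.div_const _).const_mul _).add (integrable_const _)
  have hI : Integrable (fun x => |(x - c) / (10 * σ)| ^ k) D := by
    refine hbd.mono' (Measurable.aestronglyMeasurable (by fun_prop)) ?_
    refine Filter.Eventually.of_forall fun x => ?_
    rw [Real.norm_of_nonneg (by positivity)]
    exact abs_recentre_rpow_le hk hσ hc x
  refine ⟨hI, (integral_mono hI hbd fun x => abs_recentre_rpow_le hk hσ hc x).trans ?_⟩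
  simp only [hdiv]
  rw [integral_add ((hint.div_const _).const_mul _) (integrable_const _), integral_const_mul,
    integral_div]
  have h1 : (∫ x, |x - mean D| ^ k ∂D) / σ ^ k ≤ 1 := (div_le_one (by positivity)).2 hmom
  simp only [integral_const, probReal_univ, smul_eq_mul, one_mul]
  linarith

/-! ### Correctness of the protocol -/

/-- The second-stage statistic of a round, when the first-stage estimate is `c`. -/
noncomputable def roundStatistic (m : ℕ) (k R ρ c : ℝ)
    (p : ((Fin (m + 1) → Bool) × ℝ) × ℝ) : ℝ :=
  weightedBit k R p.1.2 ((p.2 - c) / ρ)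

theorem measurable_roundStatistic (m : ℕ) (k R ρ c : ℝ) :
    Measurable (roundStatistic m k R ρ c) := by
  have h1 : Measurable fun p : ((Fin (m + 1) → Bool) × ℝ) × ℝ => (p.1.2, (p.2 - c) / ρ) := by
    fun_prop
  have h2 := (measurable_weightedBit k R).comp h1
  exact h2

theorem roundStatistic_moments {m : ℕ} {k R lam σ c : ℝ} (hk : 2 < k) (hR : 1 ≤ R) (hσ : 0 < σ)
    {D : Measure ℝ} (hD : D ∈ momentFamily k lam σ) (hc : |c - mean D| ≤ 9 * σ) :
    |∫ p, roundStatistic m k R (10 * σ) c p ∂(((codeLaw m).prod (thresholdLaw k R)).prod D) -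
        (mean D - c) / (10 * σ)| ≤ R⁻¹ ∧
      ∫ p, roundStatistic m k R (10 * σ) c p ^ 2
        ∂(((codeLaw m).prod (thresholdLaw k R)).prod D) ≤ envelopeMass k R ^ 2 := by
  have hk0 : 0 < k := by linarith
  have := isProbabilityMeasure_thresholdLaw hk hR
  have hprob : IsProbabilityMeasure D := hD.1
  obtain ⟨hint, hmom⟩ := recentred_moment hk hσ hD hc
  have hφ : Measurable fun x : ℝ => (x - c) / (10 * σ) := by fun_prop
  set D' := D.map fun x : ℝ => (x - c) / (10 * σ) with hD'
  have hD'prob : IsProbabilityMeasure D' := Measure.isProbabilityMeasure_map hφ.aemeasurable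
  have hmp : MeasurePreserving (Prod.map Prod.snd fun x : ℝ => (x - c) / (10 * σ))
      (((codeLaw m).prod (thresholdLaw k R)).prod D) ((thresholdLaw k R).prod D') :=
    measurePreserving_snd.prod ⟨hφ, rfl⟩
  have hpow : Measurable fun y : ℝ => |y| ^ k := by fun_prop
  have hint' : Integrable (fun y : ℝ => |y| ^ k) D' :=
    (integrable_map_measure hpow.aestronglyMeasurable hφ.aemeasurable).2 hint
  have hmom' : ∫ y, |y| ^ k ∂D' ≤ 1 := by
    rw [hD', integral_map hφ.aemeasurable hpow.aestronglyMeasurable]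
    exact hmom
  have hintid : Integrable (fun y : ℝ => y) D' := by
    refine (integrable_map_measure measurable_id.aestronglyMeasurable hφ.aemeasurable).2 ?_
    exact (hD.2.1.sub (integrable_const c)).div_const _
  have hmean : ∫ y, y ∂D' = (mean D - c) / (10 * σ) := by
    rw [hD', integral_map hφ.aemeasurable measurable_id'.aestronglyMeasurable, integral_div,
      integral_sub hD.2.1 (integrable_const c)]
    simp [mean]
  have h1 := integral_comp_of_measurePreserving hmp (measurable_weightedBit k R)
  have h2 := integral_comp_of_measurePreserving hmp ((measurable_weightedBit k R).pow_const 2)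
  constructor
  · rw [← hmean]
    refine le_of_eq_of_le ?_ (abs_integral_weightedBit_sub_le hk hR D' hintid hint' hmom')
    rw [← h1]
    rfl
  · refine le_of_eq_of_le ?_ (integral_weightedBit_sq_le hk hR D'
      (measureReal_le_max_rpow hk0 hint' hmom'))
    rw [← h2]
    rfl

/-- Outside two kinds of deviation events the output is correct: the first stage finds a point `c`
within `9 * σ` of the mean, and for each such `c` the average of `roundStatistic` is within
`1 / R` of its expectation, which is within `1 / R` of `(mean D - c) / (10 * σ)`. -/
theorem abs_output_sub_mean_le {m T N : ℕ} {k R lam σ : ℝ} (hk : 2 < k) (hR : 1 ≤ R) (hσ : 0 < σ)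
    (hm : lam ≤ m * σ) (hN : 0 < N) {D : Measure ℝ} (hD : D ∈ momentFamily k lam σ)
    (s : Fin (T + N) → (Fin (m + 1) → Bool) × ℝ) (x : Fin (T + N) → ℝ)
    (h1 : ∀ j : Fin (m + 1), |∑ i : Fin T, agreement lam (6 * σ) j
        (s (Fin.castAdd N i), x (Fin.castAdd N i)) -
      T * ∫ p, agreement lam (6 * σ) j p ∂(((codeLaw m).prod (thresholdLaw k R)).prod D)| <
        T * (1 / 18))
    (h2 : ∀ j : Fin (m + 1), |cellPoint lam (6 * σ) j - mean D| ≤ 9 * σ →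
      |∑ i : Fin N, roundStatistic m k R (10 * σ) (cellPoint lam (6 * σ) j)
        (s (Fin.natAdd T i), x (Fin.natAdd T i)) -
      N * ∫ p, roundStatistic m k R (10 * σ) (cellPoint lam (6 * σ) j) p
        ∂(((codeLaw m).prod (thresholdLaw k R)).prod D)| < N * R⁻¹) :
    |twoStageEstimate m T N lam (6 * σ) (10 * σ) k R
      (transcript (twoStageQuery m T (T + N) lam (6 * σ) (10 * σ)) s (T + N) x) - mean D| ≤
        20 * σ / R := by
  have := isProbabilityMeasure_thresholdLaw hk hR
  have hprob : IsProbabilityMeasure D := hD.1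
  rw [twoStageEstimate_transcript (by positivity) (by positivity)]
  set i := center m T lam (6 * σ) (fun i => (s (Fin.castAdd N i)).1)
    fun i => x (Fin.castAdd N i) with hi
  have hbest : ∀ j, ∑ t : Fin T, agreement lam (6 * σ) j
        (s (Fin.castAdd N t), x (Fin.castAdd N t)) ≤
      ∑ t : Fin T, agreement lam (6 * σ) i (s (Fin.castAdd N t), x (Fin.castAdd N t)) := fun j => by
    have := le_argmax (fun j => ∑ t : Fin T, if (s (Fin.castAdd N t)).1
      (cellIndex m lam (6 * σ) (x (Fin.castAdd N t))) = (s (Fin.castAdd N t)).1 j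
        then 1 else 0) j
    have h : ∀ j, ∑ t : Fin T, agreement lam (6 * σ) j
        (s (Fin.castAdd N t), x (Fin.castAdd N t)) = ((∑ t : Fin T, if (s (Fin.castAdd N t)).1
      (cellIndex m lam (6 * σ) (x (Fin.castAdd N t))) = (s (Fin.castAdd N t)).1 j
        then 1 else 0 : ℕ) : ℝ) := fun j => by
      push_cast
      rfl
    rw [h, h]
    exact_mod_cast this
  simp only [integral_agreement] at h1
  have hnear := abs_cellPoint_sub_le_of_agreement hσ hD.2.2.1 hm D
    (tail_le_of_mem_momentFamily hk hσ hD) h1 hbest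
  have h3 := h2 i hnear
  have h4 := (roundStatistic_moments (m := m) hk hR hσ hD hnear).1
  set c := cellPoint lam (6 * σ) i
  set I := ∫ p, roundStatistic m k R (10 * σ) c p
    ∂(((codeLaw m).prod (thresholdLaw k R)).prod D)
  simp only [roundStatistic] at h3
  set Z := ∑ i : Fin N, weightedBit k R (s (Fin.natAdd T i)).2
    ((x (Fin.natAdd T i) - c) / (10 * σ))
  have hN' : (0 : ℝ) < N := by exact_mod_cast hN
  have h5 : |Z / N - I| ≤ R⁻¹ := by
    rw [show Z / N - I = (Z - N * I) / N by field_simp, abs_div, abs_of_pos hN',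
      div_le_iff₀ hN']
    linarith
  have h6 : c + 10 * σ * (Z / N) - mean D =
      10 * σ * ((Z / N - I) + (I - (mean D - c) / (10 * σ))) := by
    field_simp; ring
  rw [h6, abs_mul, abs_of_pos (by positivity : 0 < 10 * σ)]
  calc 10 * σ * |(Z / N - I) + (I - (mean D - c) / (10 * σ))|
      ≤ 10 * σ * (R⁻¹ + R⁻¹) := by
        gcongr
        exact (abs_add_le _ _).trans (add_le_add h5 h4)
    _ = 20 * σ / R := by field_simp; ring

/-- The failure probability is at most `δ / 2` in the first stage, by a union bound over all cells,
and at most `δ / 2` in the second, by a union bound over the at most four cells within `9 * σ` of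
the mean. -/
theorem twoStageEstimator_isPAC {m T N : ℕ} {k R lam σ δ : ℝ} (hk : 2 < k) (hR : 1 ≤ R)
    (hσ : 0 < σ) (hm : lam ≤ m * σ) (hN : 0 < N)
    (hTδ : 2 * (m + 1) * Real.exp (-(T / 1296)) ≤ δ / 2)
    (hNδ : 8 * Real.exp (-(N / (4 * envelopeMass k R ^ 2 * R ^ 2))) ≤ δ / 2) :
    (twoStageEstimator m T N (lam := lam) (w := 6 * σ) (ρ := 10 * σ) (by positivity)
      (by positivity) hk hR).IsPAC (momentFamily k lam σ) (20 * σ / R) δ := by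
  intro D hD
  have := isProbabilityMeasure_thresholdLaw hk hR
  have hprob : IsProbabilityMeasure D := hD.1
  have hS := two_le_envelopeMass hk hR
  set P := ((codeLaw m).prod (thresholdLaw k R)).prod D with hP
  let good : Set ((Fin (T + N) → (Fin (m + 1) → Bool) × ℝ) × (Fin (T + N) → ℝ)) :=
    {p | |twoStageEstimate m T N lam (6 * σ) (10 * σ) k R (transcript
      (twoStageQuery m T (T + N) lam (6 * σ) (10 * σ)) p.1 (T + N) p.2) - mean D| ≤ 20 * σ / R}
  change 1 - δ ≤ ((Measure.pi fun _ : Fin (T + N) => (codeLaw m).prod (thresholdLaw k R)).prod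
    (Measure.pi fun _ : Fin (T + N) => D)).real good
  have hmp := measurePreserving_arrowProdEquivProdArrow ((Fin (m + 1) → Bool) × ℝ) ℝ (Fin (T + N))
    (fun _ => (codeLaw m).prod (thresholdLaw k R)) (fun _ => D)
  rw [Measure.real, ← hmp.measure_preimage_equiv good]
  set e := MeasurableEquiv.arrowProdEquivProdArrow ((Fin (m + 1) → Bool) × ℝ) ℝ (Fin (T + N))
  change 1 - δ ≤ (Measure.pi fun _ : Fin (T + N) => P).real (e ⁻¹' good)
  let bad₁ : Fin (m + 1) → Set (Fin (T + N) → ((Fin (m + 1) → Bool) × ℝ) × ℝ) := fun j =>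
    {ω | (Fintype.card (Fin T) : ℝ) * (1 / 18) ≤
      |∑ i : Fin T, agreement lam (6 * σ) j (ω (Fin.castAdd N i)) -
        Fintype.card (Fin T) * ∫ p, agreement lam (6 * σ) j p ∂P|}
  let bad₂ : Fin (m + 1) → Set (Fin (T + N) → ((Fin (m + 1) → Bool) × ℝ) × ℝ) := fun j =>
    {ω | (Fintype.card (Fin N) : ℝ) * R⁻¹ ≤
      |∑ i : Fin N, roundStatistic m k R (10 * σ) (cellPoint lam (6 * σ) j)
          (ω (Fin.natAdd T i)) -
        Fintype.card (Fin N) *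
          ∫ p, roundStatistic m k R (10 * σ) (cellPoint lam (6 * σ) j) p ∂P|}
  classical
  let near : Finset (Fin (m + 1)) :=
    Finset.univ.filter fun j => |cellPoint lam (6 * σ) j - mean D| ≤ 9 * σ
  have hbad₁ : ∀ j, (Measure.pi fun _ : Fin (T + N) => P).real (bad₁ j) ≤
      2 * Real.exp (-(T / 1296)) := fun j => by
    refine (measure_abs_sum_sub_ge_le P (Fin.castAdd_injective T N)
      (measurable_agreement lam (6 * σ) j) (B := 1) (V := 1) (η := 1 / 18)
      (abs_agreement_le lam (6 * σ) j) ?_ (by norm_num) (by norm_num) (by norm_num)).trans ?_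
    · calc ∫ p, agreement lam (6 * σ) j p ^ 2 ∂P ≤ ∫ _p, (1 : ℝ) ∂P := by
            refine integral_mono_of_nonneg (Filter.Eventually.of_forall fun p => sq_nonneg _)
              (integrable_const _) (Filter.Eventually.of_forall fun p => ?_)
            exact (sq_le_one_iff_abs_le_one _).2 (abs_agreement_le lam (6 * σ) j p)
        _ = 1 := by simp
    · rw [Fintype.card_fin]
      refine le_of_eq ?_
      congr 3
      ring
  have hbad₂ : ∀ j ∈ near, (Measure.pi fun _ : Fin (T + N) => P).real (bad₂ j) ≤
      2 * Real.exp (-(N / (4 * envelopeMass k R ^ 2 * R ^ 2))) := fun j hj => by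
    have hj' := (Finset.mem_filter.1 hj).2
    refine (measure_abs_sum_sub_ge_le P (Fin.natAdd_injective N T)
      (measurable_roundStatistic m k R (10 * σ) (cellPoint lam (6 * σ) j))
      (B := envelopeMass k R * R) (V := envelopeMass k R ^ 2) (η := R⁻¹)
      (fun p => abs_weightedBit_le hk hR _ _) (roundStatistic_moments hk hR hσ hD hj').2
      (by positivity) (by positivity) ?_).trans ?_
    · rw [mul_comm, mul_assoc, mul_inv_cancel₀ (by positivity)]
      nlinarith
    · rw [Fintype.card_fin]
      refine le_of_eq ?_
      congr 3
      field_simp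
  have hcover : Set.univ ⊆ e ⁻¹' good ∪ ((⋃ j ∈ Finset.univ, bad₁ j) ∪ ⋃ j ∈ near, bad₂ j) := by
    intro ω _
    by_contra hω
    simp only [Set.mem_union, Set.mem_iUnion, not_or, not_exists, Finset.mem_univ,
      forall_const] at hω
    obtain ⟨hg, hb₁, hb₂⟩ := hω
    refine hg (abs_output_sub_mean_le hk hR hσ hm hN hD _ _ (fun j => ?_) fun j hj => ?_)
    · have h := hb₁ j
      simp only [bad₁, Set.mem_ofPred_eq, not_le, Fintype.card_fin] at h
      exact h
    · have h := hb₂ j (Finset.mem_filter.2 ⟨Finset.mem_univ j, hj⟩)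
      simp only [bad₂, Set.mem_ofPred_eq, not_le, Fintype.card_fin] at h
      exact h
  have hsum₁ : (Measure.pi fun _ : Fin (T + N) => P).real (⋃ j ∈ Finset.univ, bad₁ j) ≤ δ / 2 := by
    refine (measureReal_biUnion_finset_le _ _).trans ((Finset.sum_le_sum fun j _ => hbad₁ j).trans ?_)
    rw [Finset.sum_const, Finset.card_univ, Fintype.card_fin, nsmul_eq_mul]
    push_cast
    linarith
  have hsum₂ : (Measure.pi fun _ : Fin (T + N) => P).real (⋃ j ∈ near, bad₂ j) ≤ δ / 2 := by
    refine (measureReal_biUnion_finset_le _ _).trans ((Finset.sum_le_sum hbad₂).trans ?_)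
    rw [Finset.sum_const, nsmul_eq_mul]
    have hcard : (near.card : ℝ) ≤ 4 := by
      exact_mod_cast card_near_cells_le hσ near fun j hj => (Finset.mem_filter.1 hj).2
    nlinarith [Real.exp_pos (-(N / (4 * envelopeMass k R ^ 2 * R ^ 2)))]
  have h1 := measureReal_mono (μ := Measure.pi fun _ : Fin (T + N) => P) hcover
  rw [probReal_univ] at h1
  have h2 := h1.trans (measureReal_union_le _ _)
  have h3 := measureReal_union_le (μ := Measure.pi fun _ : Fin (T + N) => P)
    (⋃ j ∈ Finset.univ, bad₁ j) (⋃ j ∈ near, bad₂ j)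
  linarith

/-! ### The number of samples -/

/-- The normalising constant is `O(1 / (k - 2))` and also `O(log R)`. The first bound is used when
`log (log r) ≥ 1`, as then `logLog k r ≥ 1 / log (k / 2) ≥ 1 / (k / 2 - 1)`, and the second
otherwise. -/
theorem envelopeMass_le_logLog {k r : ℝ} (hk : 2 < k) (hr : 1 < r) :
    envelopeMass k (20 * r) ≤ 7 * logLog k r := by
  have h2 : 2 ≤ logLog k r := le_max_left _ _
  have hlr : 0 < Real.log r := Real.log_pos hr
  rcases le_or_gt 1 (Real.log (Real.log r)) with h | h
  · have hk1 : 0 < Real.log (k / 2) := Real.log_pos (by linarith)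
    have h3 : (k / 2 - 1)⁻¹ ≤ logLog k r := by
      calc (k / 2 - 1)⁻¹ ≤ (Real.log (k / 2))⁻¹ :=
            inv_anti₀ hk1 (Real.log_le_sub_one_of_pos (by linarith))
        _ = 1 / Real.log (k / 2) := (one_div _).symm
        _ ≤ Real.log (Real.log r) / Real.log (k / 2) := by gcongr
        _ ≤ logLog k r := le_max_right _ _
    have := envelopeMass_le_inv (R := 20 * r) hk (by linarith)
    linarith
  · have h3 : Real.log r < Real.exp 1 := (Real.log_lt_iff_lt_exp hlr).1 h
    have h4 : Real.log 20 ≤ 3 := by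
      rw [Real.log_le_iff_le_exp (by norm_num)]
      have h5 : Real.exp 3 = Real.exp 1 ^ 3 := by rw [← Real.exp_nat_mul]; norm_num
      rw [h5]
      calc (20 : ℝ) ≤ 2.7182818283 ^ 3 := by norm_num
        _ ≤ Real.exp 1 ^ 3 := pow_le_pow_left₀ (by norm_num) Real.exp_one_gt_d9.le 3
    have h5 := envelopeMass_le_log (R := 20 * r) hk (by linarith)
    rw [Real.log_mul (by norm_num) (by linarith)] at h5
    linarith [Real.exp_one_lt_d9]

theorem log_sixteen_div_le {δ ℓ : ℝ} (hδ : 0 < δ) (hδ1 : δ < 1) (hℓ : 2 ≤ ℓ) :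
    Real.log (16 / δ) ≤ 4 * Real.log (ℓ / δ) := by
  rw [Real.log_div (by norm_num) hδ.ne', Real.log_div (by linarith) hδ.ne']
  have h1 : Real.log 16 = 4 * Real.log 2 := by
    rw [show (16 : ℝ) = 2 ^ 4 by norm_num, Real.log_pow]; norm_num
  have h2 : Real.log 2 ≤ Real.log ℓ := Real.log_le_log (by norm_num) hℓ
  have h3 : Real.log δ < 0 := Real.log_neg hδ hδ1
  linarith

theorem exp_neg_ceil_div_le {a z : ℝ} (ha : 0 < a) (hz : 0 < z) :
    Real.exp (-(⌈a * Real.log z⌉₊ / a)) ≤ z⁻¹ := by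
  rw [← Real.exp_log (inv_pos.2 hz), Real.log_inv]
  refine Real.exp_le_exp.2 (neg_le_neg ?_)
  rw [le_div_iff₀ ha, mul_comm]
  exact Nat.le_ceil _

theorem sample_count_le {m : ℕ} {k lam σ ε δ : ℝ} (hk : 2 < k) (hσ : 0 < σ) (hlam : σ ≤ lam)
    (hε : 0 < ε) (hεσ : ε < σ) (hδ : 0 < δ) (hδ1 : δ < 1) (hm : (m : ℝ) ≤ lam / σ + 1) :
    ((⌈1296 * Real.log (4 * (m + 1) / δ)⌉₊ +
      ⌈4 * envelopeMass k (20 * (σ / ε)) ^ 2 * (20 * (σ / ε)) ^ 2 * Real.log (16 / δ)⌉₊ : ℕ) : ℝ) ≤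
    400000 * (σ ^ 2 / ε ^ 2 * logLog k (σ / ε) ^ 3 * Real.log (logLog k (σ / ε) / δ) +
      Real.log (lam / σ)) := by
  have hr : 1 < σ / ε := (one_lt_div hε).2 hεσ
  have hq : 1 ≤ lam / σ := (one_le_div hσ).2 hlam
  have hℓ : 2 ≤ logLog k (σ / ε) := le_max_left _ _
  have hS := envelopeMass_le_logLog hk hr
  have hS2 := two_le_envelopeMass (R := 20 * (σ / ε)) hk (by linarith)
  have hL16 := log_sixteen_div_le hδ hδ1 hℓ
  rw [← div_pow]
  set r := σ / ε
  set ℓ := logLog k r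
  set L := Real.log (ℓ / δ)
  set S := envelopeMass k (20 * r)
  have hL : 1 / 2 ≤ L := by
    have h1 : Real.log 2 ≤ L := Real.log_le_log (by norm_num) (by
      rw [le_div_iff₀ hδ]; nlinarith)
    linarith [Real.log_two_gt_d9]
  have hlog16 : 0 < Real.log (16 / δ) := Real.log_pos (by rw [lt_div_iff₀ hδ]; linarith)
  have hlogq : 0 ≤ Real.log (lam / σ) := Real.log_nonneg hq
  have hT : Real.log (4 * (m + 1) / δ) ≤ 4 * L + Real.log (lam / σ) := by
    calc Real.log (4 * (m + 1) / δ) ≤ Real.log (16 / δ * (lam / σ)) := by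
          refine Real.log_le_log (by positivity) ?_
          rw [div_mul_eq_mul_div]
          exact div_le_div_of_nonneg_right (by linarith) hδ.le
      _ = Real.log (16 / δ) + Real.log (lam / σ) := Real.log_mul (by positivity) (by positivity)
      _ ≤ _ := by linarith
  have hT0 : 0 ≤ Real.log (4 * (m + 1) / δ) := Real.log_nonneg (by
    rw [le_div_iff₀ hδ]
    have : (0 : ℝ) ≤ m := m.cast_nonneg
    linarith)
  have hr2 : 1 ≤ r ^ 2 := one_le_pow₀ hr.le
  have hℓ2 : 4 ≤ ℓ ^ 2 := by nlinarith
  have hℓ3 : ℓ ^ 2 * 2 ≤ ℓ ^ 3 := by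
    rw [pow_succ ℓ 2]; gcongr
  have hX : r ^ 2 * (ℓ ^ 2 * L) * 2 ≤ r ^ 2 * ℓ ^ 3 * L := by
    calc r ^ 2 * (ℓ ^ 2 * L) * 2 = r ^ 2 * (ℓ ^ 2 * 2) * L := by ring
      _ ≤ r ^ 2 * ℓ ^ 3 * L := by gcongr
  have hX1 : 4 * L ≤ r ^ 2 * (ℓ ^ 2 * L) := by
    calc 4 * L = 1 * (4 * L) := (one_mul _).symm
      _ ≤ r ^ 2 * (ℓ ^ 2 * L) := by gcongr
  have hNle : 4 * S ^ 2 * (20 * r) ^ 2 * Real.log (16 / δ) ≤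
      313600 * (r ^ 2 * (ℓ ^ 2 * L)) := by
    calc 4 * S ^ 2 * (20 * r) ^ 2 * Real.log (16 / δ)
        ≤ 4 * (7 * ℓ) ^ 2 * (20 * r) ^ 2 * (4 * L) := by gcongr
      _ = _ := by ring
  push_cast
  have h1 := (Nat.ceil_lt_add_one (by positivity : 0 ≤ 1296 * Real.log (4 * (m + 1) / δ))).le
  have h2 := (Nat.ceil_lt_add_one
    (by positivity : 0 ≤ 4 * S ^ 2 * (20 * r) ^ 2 * Real.log (16 / δ))).le
  linarith

theorem exists_estimator {k lam σ ε δ : ℝ} (hk : 2 < k) (hσ : 0 < σ) (hlam : σ ≤ lam)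
    (hε : 0 < ε) (hεσ : ε < σ) (hδ : 0 < δ) (hδ1 : δ < 1) :
    ∃ (n : ℕ) (A : Estimator n),
      (n : ℝ) ≤ 400000 * (σ ^ 2 / ε ^ 2 * logLog k (σ / ε) ^ 3 *
        Real.log (logLog k (σ / ε) / δ) + Real.log (lam / σ)) ∧
      A.IsPAC (momentFamily k lam σ) ε δ := by
  have hr : 1 < σ / ε := (one_lt_div hε).2 hεσ
  have hR : 1 ≤ 20 * (σ / ε) := by linarith
  have hS := two_le_envelopeMass hk hR
  set m := ⌈lam / σ⌉₊
  have hm1 : lam ≤ m * σ := (div_le_iff₀ hσ).1 (Nat.le_ceil _)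
  have hm2 : (m : ℝ) ≤ lam / σ + 1 :=
    (Nat.ceil_lt_add_one (div_nonneg (by linarith) hσ.le)).le
  have hlog16 : 0 < Real.log (16 / δ) := Real.log_pos (by rw [lt_div_iff₀ hδ]; linarith)
  have hpac := twoStageEstimator_isPAC (m := m) (T := ⌈1296 * Real.log (4 * (m + 1) / δ)⌉₊)
    (N := ⌈4 * envelopeMass k (20 * (σ / ε)) ^ 2 * (20 * (σ / ε)) ^ 2 * Real.log (16 / δ)⌉₊)
    (δ := δ) hk hR hσ hm1 (Nat.ceil_pos.2 (by positivity)) ?_ ?_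
  · rw [show 20 * σ / (20 * (σ / ε)) = ε by field_simp] at hpac
    exact ⟨_, _, sample_count_le hk hσ hlam hε hεσ hδ hδ1 hm2, hpac⟩
  · calc 2 * ((m : ℝ) + 1) * Real.exp (-(⌈1296 * Real.log (4 * (m + 1) / δ)⌉₊ / 1296))
        ≤ 2 * (m + 1) * (4 * (m + 1) / δ)⁻¹ := by
          gcongr
          exact exp_neg_ceil_div_le (by norm_num) (by positivity)
      _ = δ / 2 := by field_simp; norm_num
  · calc _ ≤ 8 * (16 / δ)⁻¹ := by
          gcongr
          exact exp_neg_ceil_div_le (by positivity) (by positivity)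
      _ = δ / 2 := by field_simp; norm_num

end OneBitMean

theorem theorem4 :
    ∃ C : ℝ, 0 < C ∧
      ∀ k lam σ ε δ : ℝ, 2 < k → 0 < σ → σ ≤ lam → 0 < ε → ε < σ → 0 < δ → δ < 1 →
        ∃ (n : ℕ) (A : OneBitMean.Estimator n),
          (n : ℝ) ≤ C * (σ ^ 2 / ε ^ 2 * OneBitMean.logLog k (σ / ε) ^ 3
              * Real.log (OneBitMean.logLog k (σ / ε) / δ) + Real.log (lam / σ)) ∧
          A.IsPAC (OneBitMean.momentFamily k lam σ) ε δ := by 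
  exact ⟨400000, by norm_num, fun k lam σ ε δ hk hσ hlam hε hεσ hδ hδ1 =>
    OneBitMean.exists_estimator hk hσ hlam hε hεσ hδ hδ1⟩
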